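/- All manifolds are finite-dimensional, smooth, Hausdorff and without boundary. A subriemannian structure $(\mathcal T,\langle\cdot,\cdot\rangle^{\mathcal T})$ on a manifold $Q$ is a smooth distribution (subbundle) $\mathcal T\subset TQ$ with a positive definite inner product on its planes that depends smoothly on the point. For $\alpha\in T_x^*Q$ let $V_\alpha\in\mathcal T_x$ be the vector with $\alpha(U)=\langle V_\alpha,U\rangle^{\mathcal T}$ for all $U\in\mathcal T_x$, and let $H^{\mathcal T}(\alpha)=\tfrac12\langle V_\alpha,V_\alpha\rangle^{\mathcal T}$. A normal subriemannian geodesic is the projection to $Q$ of a trajectory in $T^*Q$ of the Hamiltonian flow of $H^{\mathcal T}$; for $\mathcal T=TQ$ these are the Riemannian geodesics. A subriemannian geodesic is a curve that is a normal geodesic, or an everywhere differentiable curve tangent to $\mathcal T$, of constant speed, that is locally length-minimizing, i.e. whose sufficiently short arcs realize the subriemannian (Carnot–Carathéodory) distance between their end points. Let $G$ be a Lie group, let $\pi:Q\to B$ be a smooth principal $G$-bundle, let $Q$ carry a subriemannian structure $(\mathcal T,\langle\cdot,\cdot\rangle^{\mathcal T})$ that is invariant under $G$ (both the distribution and the metric),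 and let $B$ carry a Riemannian metric. Suppose that $\pi$ is a subriemannian submersion: $\mathcal T$ contains a smooth subdistribution $\mathcal T^{hor}$ that is orthogonal, with respect to $\langle\cdot,\cdot\rangle^{\mathcal T}$, to the intersections of $\mathcal T$ with the tangent spaces of the fibres, and $d\pi$ maps each $\mathcal T^{hor}_q$ isometrically onto $T_{\pi(q)}B$. Theorem. Let $b\in B$, $q\in\pi^{-1}(b)$, let $I\subset\mathbb R$ be an interval with more than one point that contains $0$, and let $\gamma:I\to B$ be a Riemannian geodesic with $\gamma(0)=b$. Then there is exactly one curve $\tilde\gamma:I\to Q$ such that $\pi\circ\tilde\gamma=\gamma$, $\tilde\gamma(0)=q$, $\tilde\gamma$ is a subriemannian geodesic, and its initial velocity $\dot{\tilde\gamma}(0)$ lies in $\mathcal T^{hor}_q$. Moreover, this $\tilde\gamma$ is a normal subriemannian geodesic. -/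

import Mathlib

open Set MeasureTheory Topology
open scoped Manifold ContDiff ENNReal

noncomputable section

namespace SubRiem

/-! ### Linear algebra -/

section LinearAlgebra

variable {V : Type*} [AddCommGroup V] [Module ℝ V]

/-- A positive definite bilinear form is nondegenerate. -/
theorem nondegenerate_of_pos (b : LinearMap.BilinForm ℝ V) (hb : ∀ v, v ≠ 0 → 0 < b v v) :
    b.Nondegenerate := by
  refine ⟨fun v hv => ?_, fun v hv => ?_⟩
  · by_contra h
    exact (hb v h).ne' (hv v)
  · by_contra h
    exact (hb v h).ne' (hv v)

/-- The vector that represents a linear form `φ` with respect to the inner product `b`: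
`b (riesz b hb φ) u = φ u` for all `u`. -/
def riesz [FiniteDimensional ℝ V] (b : LinearMap.BilinForm ℝ V) (hb : ∀ v, v ≠ 0 → 0 < b v v)
    (φ : Module.Dual ℝ V) : V :=
  (b.toDual (nondegenerate_of_pos b hb)).symm φ

theorem riesz_spec [FiniteDimensional ℝ V] (b : LinearMap.BilinForm ℝ V)
    (hb : ∀ v, v ≠ 0 → 0 < b v v) (φ : Module.Dual ℝ V) (u : V) : b (riesz b hb φ) u = φ u :=
  LinearMap.BilinForm.apply_toDual_symm_apply φ u

end LinearAlgebra

section Manifold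

variable {E : Type*} [NormedAddCommGroup E] [NormedSpace ℝ E]
  {M : Type*} [TopologicalSpace M] [ChartedSpace E M]

instance instFiniteDimensionalTangentSpace [FiniteDimensional ℝ E] (x : M) :
    FiniteDimensional ℝ (TangentSpace 𝓘(ℝ, E) x) :=
  inferInstanceAs (FiniteDimensional ℝ E)

/-! ### Curves and Hamiltonian trajectories -/

/-- The curve `γ`, restricted to the set `s` of times, has velocity `v` at the time `t`
(a one-sided velocity if `t` is an end point of the interval `s`). -/
def HasVelocityWithinAt (γ : ℝ → M) (s : Set ℝ) (t : ℝ)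
    (v : TangentSpace 𝓘(ℝ, E) (γ t)) : Prop :=
  HasMFDerivWithinAt 𝓘(ℝ, ℝ) 𝓘(ℝ, E) γ s t ((1 : ℝ →L[ℝ] ℝ).smulRight v)

/-- The coordinate expression, in the chart `e`, of a covector `α` at `x`: the linear form
`α ∘ (de_x)⁻¹` on the model space. -/
def chartCovector (e : OpenPartialHomeomorph M E) (x : M)
    (α : TangentSpace 𝓘(ℝ, E) x →L[ℝ] ℝ) : E →L[ℝ] ℝ :=
  let A : TangentSpace 𝓘(ℝ, E) x →L[ℝ] E := mfderiv 𝓘(ℝ, E) 𝓘(ℝ, E) e x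
  α ∘L A.inverse

/-- The coordinate expression of a function `H` on the cotangent bundle, in the canonical
coordinates `(y, p)` which the chart `e` induces on the cotangent bundle. -/
def chartHamiltonian (H : ∀ x : M, (TangentSpace 𝓘(ℝ, E) x →L[ℝ] ℝ) → ℝ)
    (e : OpenPartialHomeomorph M E) (y : E) (p : E →L[ℝ] ℝ) : ℝ :=
  let A : TangentSpace 𝓘(ℝ, E) (e.symm y) →L[ℝ] E := mfderiv 𝓘(ℝ, E) 𝓘(ℝ, E) e (e.symm y)
  H (e.symm y) (p ∘L A)

/-- `t ↦ (γ t, α t)`, for `t` in the interval `I`, is a trajectory in the cotangent bundle of the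
Hamiltonian flow of `H`, with respect to the canonical symplectic structure: in the canonical
coordinates `(y, p)` of every smooth chart it satisfies Hamilton's equations
`dy/dt = ∂H/∂p`, `dp/dt = -∂H/∂y`. The first equation, between elements of the finite-dimensional
model space, is tested against all linear forms `ξ`. -/
def IsHamiltonianTrajectory (H : ∀ x : M, (TangentSpace 𝓘(ℝ, E) x →L[ℝ] ℝ) → ℝ) (I : Set ℝ)
    (γ : ℝ → M) (α : ∀ t : ℝ, TangentSpace 𝓘(ℝ, E) (γ t) →L[ℝ] ℝ) : Prop :=
  ContinuousOn γ I ∧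
  ∀ t ∈ I, ∀ e ∈ IsManifold.maximalAtlas 𝓘(ℝ, E) ∞ M, γ t ∈ e.source →
    (∀ ξ : E →L[ℝ] ℝ, HasDerivWithinAt (fun s => ξ (e (γ s)))
      (fderiv ℝ (fun p => chartHamiltonian H e (e (γ t)) p) (chartCovector e (γ t) (α t)) ξ) I t) ∧
    HasDerivWithinAt (fun s => chartCovector e (γ s) (α s))
      (-fderiv ℝ (fun y => chartHamiltonian H e y (chartCovector e (γ t) (α t))) (e (γ t))) I t

/-! ### Riemannian geodesics -/

/-- A smooth Riemannian metric on the manifold `M`. -/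
abbrev RiemannianMetric (E : Type*) [NormedAddCommGroup E] [NormedSpace ℝ E]
    (M : Type*) [TopologicalSpace M] [ChartedSpace E M] [IsManifold 𝓘(ℝ, E) ∞ M] :=
  Bundle.ContMDiffRiemannianMetric 𝓘(ℝ, E) ∞ E (fun x : M => TangentSpace 𝓘(ℝ, E) x)

/-- The inner product on the tangent space at `x`, as a bilinear form. -/
def RiemannianMetric.bilin [IsManifold 𝓘(ℝ, E) ∞ M] (g : RiemannianMetric E M) (x : M) :
    LinearMap.BilinForm ℝ (TangentSpace 𝓘(ℝ, E) x) :=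
  LinearMap.mk₂ ℝ (fun v w => g.inner x v w) (by simp) (by simp) (by simp) (by simp)

/-- The Riemannian (kinetic energy) Hamiltonian `β ↦ ½ ⟨V, V⟩`, where `V` is the vector dual to
the covector `β`. -/
def RiemannianMetric.hamiltonian [FiniteDimensional ℝ E] [IsManifold 𝓘(ℝ, E) ∞ M]
    (g : RiemannianMetric E M) (x : M) (β : TangentSpace 𝓘(ℝ, E) x →L[ℝ] ℝ) : ℝ :=
  let V := riesz (RiemannianMetric.bilin g x) (fun v hv => g.pos x v hv) β.toLinearMap
  (1 / 2) * g.inner x V V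

/-- Riemannian geodesics, parametrized by the interval `I`: the projections of the trajectories of
the Hamiltonian flow of the kinetic energy. -/
def IsRiemannianGeodesic [FiniteDimensional ℝ E] [IsManifold 𝓘(ℝ, E) ∞ M]
    (g : RiemannianMetric E M) (I : Set ℝ) (γ : ℝ → M) : Prop :=
  ∃ β : ∀ t : ℝ, TangentSpace 𝓘(ℝ, E) (γ t) →L[ℝ] ℝ,
    IsHamiltonianTrajectory (RiemannianMetric.hamiltonian g) I γ β

/-! ### Distributions and subriemannian metrics -/

/-- The field of vectors `X` is smooth on `U`. -/
def IsSmoothFieldOn (X : ∀ x : M, TangentSpace 𝓘(ℝ, E) x) (U : Set M)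
    [IsManifold 𝓘(ℝ, E) ∞ M] : Prop :=
  ContMDiffOn 𝓘(ℝ, E) 𝓘(ℝ, E).tangent ∞ (fun x => (⟨x, X x⟩ : TangentBundle 𝓘(ℝ, E) M)) U

/-- A (smooth) distribution: a field of planes which near each point is spanned by a frame of
smooth vector fields, that is, a smooth subbundle of the tangent bundle. -/
def IsSmoothDistribution [IsManifold 𝓘(ℝ, E) ∞ M]
    (D : ∀ x : M, Submodule ℝ (TangentSpace 𝓘(ℝ, E) x)) : Prop :=
  ∀ x₀ : M, ∃ U : Set M, IsOpen U ∧ x₀ ∈ U ∧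
    ∃ (r : ℕ) (X : Fin r → ∀ x : M, TangentSpace 𝓘(ℝ, E) x),
      (∀ i, IsSmoothFieldOn (X i) U) ∧
      ∀ x ∈ U, LinearIndependent ℝ (fun i => X i x) ∧
        Submodule.span ℝ (range fun i => X i x) = D x

/-- A subriemannian structure on `M`: a distribution, with a positive definite inner product on
each of its planes that depends smoothly on the point. -/
structure SubriemannianStructure (E : Type*) [NormedAddCommGroup E] [NormedSpace ℝ E]
    (M : Type*) [TopologicalSpace M] [ChartedSpace E M] [IsManifold 𝓘(ℝ, E) ∞ M] where
  /-- the distribution -/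
  dist : ∀ x : M, Submodule ℝ (TangentSpace 𝓘(ℝ, E) x)
  smooth_dist : IsSmoothDistribution dist
  /-- the subriemannian metric -/
  inner : ∀ x : M, LinearMap.BilinForm ℝ (dist x)
  symm : ∀ (x : M) (v w : dist x), inner x v w = inner x w v
  pos : ∀ (x : M) (v : dist x), v ≠ 0 → 0 < inner x v v
  smooth_inner : ∀ (U : Set M), IsOpen U → ∀ (X Y : ∀ x : M, dist x),
    IsSmoothFieldOn (fun x => (X x : TangentSpace 𝓘(ℝ, E) x)) U →
    IsSmoothFieldOn (fun x => (Y x : TangentSpace 𝓘(ℝ, E) x)) U →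
    ContMDiffOn 𝓘(ℝ, E) 𝓘(ℝ, ℝ) ∞ (fun x => inner x (X x) (Y x)) U

namespace SubriemannianStructure

variable [IsManifold 𝓘(ℝ, E) ∞ M] (g : SubriemannianStructure E M)

/-- The bundle map from covectors to the distribution: `g.sharp x α` is the vector `V` of the
plane at `x` with `α U = ⟨V, U⟩` for all vectors `U` of that plane. -/
def sharp [FiniteDimensional ℝ E] (x : M) (α : TangentSpace 𝓘(ℝ, E) x →L[ℝ] ℝ) : g.dist x :=
  riesz (g.inner x) (g.pos x) (α.toLinearMap ∘ₗ (g.dist x).subtype)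

/-- The subriemannian Hamiltonian `α ↦ ½ ⟨V, V⟩`, where `V = g.sharp x α`. -/
def hamiltonian [FiniteDimensional ℝ E] (x : M) (α : TangentSpace 𝓘(ℝ, E) x →L[ℝ] ℝ) : ℝ :=
  (1 / 2) * g.inner x (g.sharp x α) (g.sharp x α)

/-- Normal subriemannian geodesics, parametrized by the interval `I`: the projections of the
trajectories of the Hamiltonian flow of the subriemannian Hamiltonian. -/
def IsNormalGeodesic [FiniteDimensional ℝ E] (I : Set ℝ) (γ : ℝ → M) : Prop :=
  ∃ α : ∀ t : ℝ, TangentSpace 𝓘(ℝ, E) (γ t) →L[ℝ] ℝ,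
    IsHamiltonianTrajectory g.hamiltonian I γ α

/-- The speed at time `t` of the curve `σ` restricted to `s`; by convention it is infinite if `σ`
has no velocity at `t` that lies in the distribution. -/
def speed (s : Set ℝ) (σ : ℝ → M) (t : ℝ) : ℝ≥0∞ :=
  ⨅ (v : g.dist (σ t)) (_ : HasVelocityWithinAt σ s t (v : TangentSpace 𝓘(ℝ, E) (σ t))),
    ENNReal.ofReal (Real.sqrt (g.inner (σ t) v v))

/-- The length of the curve `σ` on the interval `[a, b]`. -/
def length (a b : ℝ) (σ : ℝ → M) : ℝ≥0∞ :=
  ∫⁻ t in Icc a b, g.speed (Icc a b) σ t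

/-- Absolutely continuous curves on `[a, b]` (absolute continuity is tested against all smooth
functions) that are admissible, that is, tangent to the distribution at almost all times. -/
def IsAdmissible (a b : ℝ) (σ : ℝ → M) : Prop :=
  ContinuousOn σ (Icc a b) ∧
  (∀ f : M → ℝ, ContMDiff 𝓘(ℝ, E) 𝓘(ℝ, ℝ) ∞ f →
    AbsolutelyContinuousOnInterval (f ∘ σ) a b) ∧
  ∀ᵐ t ∂(volume.restrict (Icc a b)), ∃ v : g.dist (σ t),
    HasVelocityWithinAt σ (Icc a b) t (v : TangentSpace 𝓘(ℝ, E) (σ t))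

/-- The subriemannian (Carnot-Caratheodory) distance: the infimum of the lengths of the absolutely
continuous admissible curves that join two points (infinite if there is none). -/
def ccDist (x y : M) : ℝ≥0∞ :=
  ⨅ (σ : ℝ → M) (_ : g.IsAdmissible 0 1 σ ∧ σ 0 = x ∧ σ 1 = y), g.length 0 1 σ

/-- Length-minimizing geodesics on the interval `I`: curves tangent to the distribution,
with constant speed, each sufficiently short arc of which realizes the subriemannian distance
between its end points. -/
def IsMinimizingGeodesic (I : Set ℝ) (γ : ℝ → M) : Prop :=
  (∃ c : ℝ, ∀ t ∈ I, ∃ v : g.dist (γ t),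
    HasVelocityWithinAt γ I t (v : TangentSpace 𝓘(ℝ, E) (γ t)) ∧ g.inner (γ t) v v = c) ∧
  ∀ t ∈ I, ∃ ε > 0, ∀ t₁ ∈ I ∩ Ioo (t - ε) (t + ε), ∀ t₂ ∈ I ∩ Ioo (t - ε) (t + ε), t₁ ≤ t₂ →
    g.length t₁ t₂ γ = g.ccDist (γ t₁) (γ t₂)

/-- Subriemannian geodesics: the normal geodesics, and all the constant speed curves, normal or
not, that are locally length-minimizing among the admissible curves. -/
def IsGeodesic [FiniteDimensional ℝ E] (I : Set ℝ) (γ : ℝ → M) : Prop :=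
  g.IsNormalGeodesic I γ ∨ g.IsMinimizingGeodesic I γ

end SubriemannianStructure

end Manifold

/-! ### Principal bundles and subriemannian submersions -/

section Bundle

variable {EQ : Type*} [NormedAddCommGroup EQ] [NormedSpace ℝ EQ]
  {Q : Type*} [TopologicalSpace Q] [ChartedSpace EQ Q]
  {EB : Type*} [NormedAddCommGroup EB] [NormedSpace ℝ EB]
  {B : Type*} [TopologicalSpace B] [ChartedSpace EB B]

/-- `π : Q → B` is a smooth principal bundle with structure group `G`: the group acts smoothly
on `Q`, preserving the fibres, and each point of `B` has a neighbourhood `U` over which there is an equivariant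
diffeomorphism `π⁻¹(U) ≃ U × G` over `U`. (The action is written on the left; a right action is
turned into a left one by inversion in the group.) -/
structure IsPrincipalBundle {EG : Type*} [NormedAddCommGroup EG] [NormedSpace ℝ EG]
    (G : Type*) [Group G] [TopologicalSpace G] [ChartedSpace EG G] [MulAction G Q]
    (π : Q → B) : Prop where
  smooth_proj : ContMDiff 𝓘(ℝ, EQ) 𝓘(ℝ, EB) ∞ π
  smooth_action : ContMDiffSMul 𝓘(ℝ, EG) 𝓘(ℝ, EQ) ∞ G Q
  proj_smul : ∀ (h : G) (q : Q), π (h • q) = π q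
  locally_trivial : ∀ b : B, ∃ (U : Set B) (e : OpenPartialHomeomorph Q (B × G)),
    IsOpen U ∧ b ∈ U ∧ e.source = π ⁻¹' U ∧ e.target = U ×ˢ univ ∧
    ContMDiffOn 𝓘(ℝ, EQ) (𝓘(ℝ, EB).prod 𝓘(ℝ, EG)) ∞ e e.source ∧
    ContMDiffOn (𝓘(ℝ, EB).prod 𝓘(ℝ, EG)) 𝓘(ℝ, EQ) ∞ e.symm e.target ∧
    ∀ q ∈ e.source, (e q).1 = π q ∧ ∀ h : G, e (h • q) = (π q, h * (e q).2)

/-- `π` is a subriemannian submersion with horizontal subdistribution `hor`: the distribution of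
`Q` contains `hor`, which is orthogonal to the vectors of the distribution that are tangent to the
fibres, and which the differential of `π` maps isometrically onto the tangent spaces of `B`. -/
structure IsSubriemannianSubmersion [IsManifold 𝓘(ℝ, EQ) ∞ Q] [IsManifold 𝓘(ℝ, EB) ∞ B]
    (π : Q → B) (gQ : SubriemannianStructure EQ Q) (gB : RiemannianMetric EB B)
    (hor : ∀ q : Q, Submodule ℝ (TangentSpace 𝓘(ℝ, EQ) q)) : Prop where
  smooth_hor : IsSmoothDistribution hor
  hor_le : ∀ q, hor q ≤ gQ.dist q
  orthogonal : ∀ (q : Q) (v w : gQ.dist q), (v : TangentSpace 𝓘(ℝ, EQ) q) ∈ hor q →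
    mfderiv 𝓘(ℝ, EQ) 𝓘(ℝ, EB) π q w = 0 → gQ.inner q v w = 0
  isometric : ∀ (q : Q) (v w : gQ.dist q), (v : TangentSpace 𝓘(ℝ, EQ) q) ∈ hor q →
    (w : TangentSpace 𝓘(ℝ, EQ) q) ∈ hor q →
    gB.inner (π q) (mfderiv 𝓘(ℝ, EQ) 𝓘(ℝ, EB) π q v) (mfderiv 𝓘(ℝ, EQ) 𝓘(ℝ, EB) π q w) =
      gQ.inner q v w
  surjective : ∀ (q : Q) (u : TangentSpace 𝓘(ℝ, EB) (π q)),
    ∃ v ∈ hor q, mfderiv 𝓘(ℝ, EQ) 𝓘(ℝ, EB) π q v = u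

/-- The distribution and the subriemannian metric are invariant under the action of `G`. -/
def IsInvariant [IsManifold 𝓘(ℝ, EQ) ∞ Q] (G : Type*) [Group G] [MulAction G Q]
    (gQ : SubriemannianStructure EQ Q) : Prop :=
  ∀ (h : G) (q : Q) (v : gQ.dist q),
    ∃ hv : mfderiv 𝓘(ℝ, EQ) 𝓘(ℝ, EQ) (fun x : Q => h • x) q v ∈ gQ.dist (h • q),
    ∀ (w : gQ.dist q)
      (hw : mfderiv 𝓘(ℝ, EQ) 𝓘(ℝ, EQ) (fun x : Q => h • x) q w ∈ gQ.dist (h • q)),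
      gQ.inner (h • q) ⟨_, hv⟩ ⟨_, hw⟩ = gQ.inner q v w

/-- `γ'` is a lift of the curve `γ`, defined on the interval `I`, to a subriemannian geodesic of
`Q` that starts (at time `0`) at the point `q` with velocity vector in `hor`. -/
structure IsHorizontalGeodesicLift [FiniteDimensional ℝ EQ] [IsManifold 𝓘(ℝ, EQ) ∞ Q]
    (π : Q → B) (gQ : SubriemannianStructure EQ Q)
    (hor : ∀ q : Q, Submodule ℝ (TangentSpace 𝓘(ℝ, EQ) q))
    (I : Set ℝ) (γ : ℝ → B) (q : Q) (γ' : ℝ → Q) : Prop where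
  lift : ∀ t ∈ I, π (γ' t) = γ t
  start : γ' 0 = q
  geodesic : gQ.IsGeodesic I γ'
  velocity : ∃ v ∈ hor (γ' 0), HasVelocityWithinAt γ' I 0 v

end Bundle

end SubRiem

end

/-! Orthogonality and isometry together say that the vector dual to a pulled back covector `β ∘ dπ`
is the horizontal vector over the vector dual to `β` (`sharpMap_pullback`). Let `β t` be the
covectors along the base geodesic, and call a curve over it a horizontal lift if its velocity is
always dual to `β t ∘ dπ`.

Horizontal lifts are normal, with covectors `β t ∘ dπ` (`IsHorLift.isHamiltonianTrajectory`). The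
first Hamilton equation holds by definition. The second comes from differentiating, in charts, the
relation `dπ ∘ S ∘ dπ* = T` between the two cometrics (`fderiv_cometric_of_submersion`) and from the
symmetry of second derivatives.

Horizontal lifts exist and are unique. In charts they solve `y' = A(y) w(t)` with `A` smooth and `w`
continuous, which gives local existence and uniqueness. The group permutes the horizontal lifts and
is transitive on the fibres, so local lifts can be moved to fit each other and glued along all of
`I` (`exists_horLift`).

Finally, every geodesic lift with horizontal initial velocity is a horizontal lift
(`IsHorizontalGeodesicLift.isHorLift`). Its speed is constant, by conservation of energy if it is
normal and by definition if it is minimizing; so is the speed of the base geodesic. By Pythagoras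
the squared speeds differ by the squared length of the vertical part of the velocity. They agree at
time `0`, hence always, and the vertical part vanishes. -/

set_option linter.unusedSectionVars false

noncomputable section

namespace SubRiem

/-! ### The cometric of a subriemannian structure -/

section Cometric

variable {E : Type*} [NormedAddCommGroup E] [NormedSpace ℝ E]
  {M : Type*} [TopologicalSpace M] [ChartedSpace E M]
  {E' : Type*} [NormedAddCommGroup E'] [NormedSpace ℝ E']
  {N : Type*} [TopologicalSpace N] [ChartedSpace E' N]

/-- The differential of `f` at `x`, as a map between the model spaces. -/
def mdiff (f : M → N) (x : M) : E →L[ℝ] E' := mfderiv 𝓘(ℝ, E) 𝓘(ℝ, E') f x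

namespace SubriemannianStructure

variable [IsManifold 𝓘(ℝ, E) ∞ M] (g : SubriemannianStructure E M)

/-- The plane of the distribution at `x`, as a subspace of the model space. -/
def plane (x : M) : Submodule ℝ E := g.dist x

/-- The inner product on the plane at `x`. -/
def form (x : M) : LinearMap.BilinForm ℝ (g.plane x) := g.inner x

theorem form_symm (x : M) (u v : g.plane x) : g.form x u v = g.form x v u := g.symm x u v

theorem form_pos (x : M) (v : g.plane x) (hv : v ≠ 0) : 0 < g.form x v v := g.pos x v hv

variable [FiniteDimensional ℝ E]

/-- The vector of the plane at `x` dual to the covector `p`. -/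
def planeSharp (x : M) (p : E →L[ℝ] ℝ) : g.plane x := g.sharp x p

theorem form_planeSharp (x : M) (p : E →L[ℝ] ℝ) (u : g.plane x) :
    g.form x (g.planeSharp x p) u = p u :=
  riesz_spec (g.inner x) (g.pos x) _ _

/-- Positive definiteness: the difference of two representing vectors is orthogonal to itself. This
is how dual vectors are identified throughout. -/
theorem eq_planeSharp {x : M} {p : E →L[ℝ] ℝ} {v : g.plane x}
    (h : ∀ u, g.form x v u = p u) : v = g.planeSharp x p := by
  by_contra hne
  have h0 : v - g.planeSharp x p ≠ 0 := sub_ne_zero.2 hne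
  refine (g.form_pos x _ h0).ne' ?_
  rw [LinearMap.map_sub₂, h, form_planeSharp, sub_self]

/-- The bundle map from covectors to the distribution, as a linear map. -/
def sharpMap (x : M) : (E →L[ℝ] ℝ) →L[ℝ] E :=
  LinearMap.toContinuousLinearMap
    { toFun := fun p => (g.planeSharp x p : E)
      map_add' := fun p q => by
        rw [← Submodule.coe_add, ← g.eq_planeSharp (x := x) (p := p + q)]
        intro u
        rw [map_add, LinearMap.add_apply, form_planeSharp, form_planeSharp]; rfl
      map_smul' := fun c p => by
        rw [RingHom.id_apply, ← Submodule.coe_smul, ← g.eq_planeSharp (x := x) (p := c • p)]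
        intro u
        rw [map_smul, LinearMap.smul_apply, form_planeSharp]; rfl }

theorem sharpMap_apply (x : M) (p : E →L[ℝ] ℝ) : g.sharpMap x p = g.planeSharp x p := rfl

/-- Both sides are the inner product of the two dual vectors. -/
theorem sharpMap_symm (x : M) (p q : E →L[ℝ] ℝ) :
    p (g.sharpMap x q) = q (g.sharpMap x p) := by
  rw [sharpMap_apply, sharpMap_apply, ← form_planeSharp, ← form_planeSharp, form_symm]

/-- Since `⟨V, V⟩ = p V` for the dual vector `V`, the Hamiltonian is a quadratic form in the
covector, and its derivatives reduce to those of the cometric. -/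
theorem hamiltonian_eq (x : M) (p : E →L[ℝ] ℝ) :
    g.hamiltonian x p = (1 / 2) * p (g.sharpMap x p) :=
  congrArg ((1 / 2 : ℝ) * ·) (g.form_planeSharp x p (g.planeSharp x p))

/-- The coordinate expression of the cometric in the chart `e`. -/
def chartCometric (e : OpenPartialHomeomorph M E) (y : E) : (E →L[ℝ] ℝ) →L[ℝ] E :=
  mdiff e (e.symm y) ∘L g.sharpMap (e.symm y) ∘L
    ContinuousLinearMap.precomp ℝ (mdiff e (e.symm y))

theorem chartCometric_apply (e : OpenPartialHomeomorph M E) (y : E) (p : E →L[ℝ] ℝ) :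
    g.chartCometric e y p =
      mdiff e (e.symm y) (g.sharpMap (e.symm y) (p ∘L mdiff e (e.symm y))) := rfl

theorem chartCometric_symm (e : OpenPartialHomeomorph M E) (y : E) (p q : E →L[ℝ] ℝ) :
    p (g.chartCometric e y q) = q (g.chartCometric e y p) :=
  g.sharpMap_symm (e.symm y) (p ∘L mdiff e (e.symm y)) (q ∘L mdiff e (e.symm y))

theorem chartHamiltonian_eq (e : OpenPartialHomeomorph M E) (y : E) (p : E →L[ℝ] ℝ) :
    chartHamiltonian g.hamiltonian e y p = (1 / 2) * p (g.chartCometric e y p) :=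
  g.hamiltonian_eq _ _

end SubriemannianStructure

theorem mdifferentiable_of_mem_maximalAtlas [IsManifold 𝓘(ℝ, E) ∞ M]
    {e : OpenPartialHomeomorph M E}
    (he : e ∈ IsManifold.maximalAtlas 𝓘(ℝ, E) ∞ M) : e.MDifferentiable 𝓘(ℝ, E) 𝓘(ℝ, E) :=
  ⟨(contMDiffOn_of_mem_maximalAtlas he).mdifferentiableOn (by simp),
    (contMDiffOn_symm_of_mem_maximalAtlas he).mdifferentiableOn (by simp)⟩

/-- The coordinate expression of a smooth field of vectors is smooth. -/
theorem IsSmoothFieldOn.contDiffOn_chart [IsManifold 𝓘(ℝ, E) ∞ M]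
    {X : ∀ x : M, TangentSpace 𝓘(ℝ, E) x} {U : Set M} (hX : IsSmoothFieldOn X U)
    {e : OpenPartialHomeomorph M E} (he : e ∈ IsManifold.maximalAtlas 𝓘(ℝ, E) ∞ M) :
    ContDiffOn ℝ ∞ (fun y => mdiff (E := E) (E' := E) e (e.symm y) (X (e.symm y)))
      (e.target ∩ e.symm ⁻¹' U) := by
  have h1 : ContMDiffOn 𝓘(ℝ, E) 𝓘(ℝ, E).tangent ∞
      (fun y => (⟨e.symm y, X (e.symm y)⟩ : TangentBundle 𝓘(ℝ, E) M))
      (e.target ∩ e.symm ⁻¹' U) :=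
    ContMDiffOn.comp hX ((contMDiffOn_symm_of_mem_maximalAtlas he).mono inter_subset_left)
      inter_subset_right
  have h2 := ((contMDiffOn_of_mem_maximalAtlas he).contMDiffOn_tangentMapWithin
    (m := ∞) (by simp) e.open_source.uniqueMDiffOn).comp h1
    (fun y hy => e.map_target hy.1)
  have h3 := (contMDiff_snd_tangentBundle_modelSpace E 𝓘(ℝ, E) (n := ∞)).comp_contMDiffOn h2
  refine ContDiffOn.congr h3.contDiffOn fun y hy => ?_
  change mdiff (E := E) (E' := E) e (e.symm y) (X (e.symm y)) =
    mfderivWithin 𝓘(ℝ, E) 𝓘(ℝ, E) e e.source (e.symm y) (X (e.symm y))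
  rw [mfderivWithin_of_isOpen e.open_source (e.map_target hy.1)]; rfl

end Cometric

/-! ### Frames and Gram matrices -/

section Gram

variable {E : Type*} [NormedAddCommGroup E] [NormedSpace ℝ E]

/-- The linear combination map of a finite family. -/
def combMap {r : ℕ} (X : Fin r → E) : (Fin r → ℝ) →L[ℝ] E :=
  ∑ i, (ContinuousLinearMap.proj (R := ℝ) (φ := fun _ : Fin r => ℝ) i).smulRight (X i)

theorem combMap_apply {r : ℕ} (X : Fin r → E) (c : Fin r → ℝ) :
    combMap X c = ∑ i, c i • X i := by
  simp [combMap]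

/-- The map that evaluates a covector at the members of a finite family. -/
def evalMap {r : ℕ} (X : Fin r → E) : (E →L[ℝ] ℝ) →L[ℝ] (Fin r → ℝ) :=
  ContinuousLinearMap.pi fun i => ContinuousLinearMap.apply ℝ ℝ (X i)

/-- The endomorphism given by a square array of coefficients. -/
def gramMap {r : ℕ} (a : Fin r → Fin r → ℝ) : (Fin r → ℝ) →L[ℝ] (Fin r → ℝ) :=
  ContinuousLinearMap.pi fun i => ∑ j, a j i • ContinuousLinearMap.proj (R := ℝ) j

theorem gramMap_apply {r : ℕ} (a : Fin r → Fin r → ℝ) (c : Fin r → ℝ) (i : Fin r) :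
    gramMap a c i = ∑ j, c j * a j i := by
  simp [gramMap, mul_comm]

theorem ContDiffOn.combMap {F : Type*} [NormedAddCommGroup F] [NormedSpace ℝ F] {r : ℕ}
    {X : F → Fin r → E} {s : Set F} (hX : ∀ i, ContDiffOn ℝ ∞ (fun y => X y i) s) :
    ContDiffOn ℝ ∞ (fun y => SubRiem.combMap (X y)) s := by
  rw [contDiffOn_clm_apply]
  intro c
  simp only [combMap_apply]
  exact ContDiffOn.sum fun i _ => contDiffOn_const.smul (hX i)

theorem ContDiffOn.evalMap [FiniteDimensional ℝ E] {F : Type*} [NormedAddCommGroup F]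
    [NormedSpace ℝ F] {r : ℕ}
    {X : F → Fin r → E} {s : Set F} (hX : ∀ i, ContDiffOn ℝ ∞ (fun y => X y i) s) :
    ContDiffOn ℝ ∞ (fun y => SubRiem.evalMap (X y)) s := by
  rw [contDiffOn_clm_apply]
  intro p
  rw [contDiffOn_pi]
  exact fun i => p.contDiff.comp_contDiffOn (hX i)

theorem ContDiffOn.gramMap {F : Type*} [NormedAddCommGroup F] [NormedSpace ℝ F] {r : ℕ}
    {a : F → Fin r → Fin r → ℝ} {s : Set F} (ha : ∀ i j, ContDiffOn ℝ ∞ (fun y => a y i j) s) :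
    ContDiffOn ℝ ∞ (fun y => SubRiem.gramMap (a y)) s := by
  rw [contDiffOn_clm_apply]
  intro c
  rw [contDiffOn_pi]
  intro i
  simp only [gramMap_apply]
  exact ContDiffOn.sum fun j _ => contDiffOn_const.mul (ha j i)

variable {P : Type*} [AddCommGroup P] [Module ℝ P]

theorem form_comb_left (b : LinearMap.BilinForm ℝ P) {r : ℕ} (X : Fin r → P) (c : Fin r → ℝ)
    (i : Fin r) : b (∑ j, c j • X j) (X i) = gramMap (fun i j => b (X i) (X j)) c i := by
  rw [gramMap_apply]; simp [LinearMap.sum_apply]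

/-- A coefficient vector in the kernel gives a combination of the family of length zero, so it
vanishes by independence; in finite dimension injectivity suffices. -/
theorem gramMap_isInvertible (b : LinearMap.BilinForm ℝ P) (hb : ∀ v, v ≠ 0 → 0 < b v v)
    {r : ℕ} {X : Fin r → P} (hX : LinearIndependent ℝ X) :
    (gramMap fun i j => b (X i) (X j)).IsInvertible := by
  set A := gramMap fun i j => b (X i) (X j) with hA
  have hinj : Function.Injective A := by
    refine (injective_iff_map_eq_zero A).2 fun c hc => ?_
    have h0 : ∑ j, c j • X j = 0 := by
      by_contra hne
      refine (hb _ hne).ne' ?_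
      conv_lhs => rw [map_sum]
      refine Finset.sum_eq_zero fun i _ => ?_
      rw [map_smul, form_comb_left, ← hA, hc]; simp
    exact funext (Fintype.linearIndependent_iff.1 hX c h0)
  have hbij : Function.Bijective A.toLinearMap :=
    ⟨hinj, LinearMap.injective_iff_surjective.1 hinj⟩
  exact ⟨(LinearEquiv.ofBijective A.toLinearMap hbij).toContinuousLinearEquiv, rfl⟩

end Gram

/-! ### Smoothness of the cometric -/

section Smooth

variable {E : Type*} [NormedAddCommGroup E] [NormedSpace ℝ E] [FiniteDimensional ℝ E]
  {M : Type*} [TopologicalSpace M] [ChartedSpace E M] [IsManifold 𝓘(ℝ, E) ∞ M]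

namespace SubriemannianStructure

variable (g : SubriemannianStructure E M)

/-- The coefficients of the dual vector in a frame solve the Gram system whose right-hand side is
the values of the covector on the frame. -/
theorem sharpMap_eq_frame (x : M) {r : ℕ} (X : Fin r → g.plane x)
    (hX : LinearIndependent ℝ X) (hs : Submodule.span ℝ (range X) = ⊤) :
    g.sharpMap x = combMap (fun i => (X i : E)) ∘L
      (gramMap fun i j => g.form x (X i) (X j)).inverse ∘L evalMap (fun i => (X i : E)) := by
  ext p
  set c := (gramMap fun i j => g.form x (X i) (X j)).inverse (evalMap (fun i => (X i : E)) p)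
    with hc
  have hgc : gramMap (fun i j => g.form x (X i) (X j)) c = evalMap (fun i => (X i : E)) p :=
    (gramMap_isInvertible _ (g.form_pos x) hX).self_apply_inverse _
  have : (∑ j, c j • X j) = g.planeSharp x p := by
    apply g.eq_planeSharp
    intro u
    have : g.form x (∑ j, c j • X j) = p.toLinearMap ∘ₗ (g.plane x).subtype := by
      refine LinearMap.ext_on_range hs fun i => ?_
      rw [form_comb_left, hgc]; rfl
    rw [this]; rfl
  change _ = combMap (fun i => (X i : E)) c
  rw [combMap_apply, sharpMap_apply, ← this]; simp

/-- In a smooth local frame the cometric is built from the frame and the inverse Gram matrix, both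
smooth in the point. -/
theorem contDiffOn_chartCometric {e : OpenPartialHomeomorph M E}
    (he : e ∈ IsManifold.maximalAtlas 𝓘(ℝ, E) ∞ M) :
    ContDiffOn ℝ ∞ (g.chartCometric e) e.target := by
  classical
  intro y₀ hy₀
  obtain ⟨U, hU, hxU, r, X, hXs, hX⟩ := g.smooth_dist (e.symm y₀)
  set O : Set E := e.target ∩ e.symm ⁻¹' U with hO
  have hOo : IsOpen O := e.isOpen_inter_preimage_symm hU
  -- `smooth_inner` takes fields that lie in the distribution everywhere, but the frame does so only
  -- on `U`; where a field leaves the distribution it is replaced by zero.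
  let X' : Fin r → ∀ x : M, g.plane x := fun i x =>
    if h : X i x ∈ g.dist x then ⟨X i x, h⟩ else 0
  have hmem : ∀ x ∈ U, ∀ i, X i x ∈ g.dist x := fun x hx i =>
    (hX x hx).2 ▸ Submodule.subset_span (mem_range_self i)
  have hX' : ∀ x ∈ U, ∀ i, (X' i x : E) = X i x := fun x hx i => by
    simp only [X', dif_pos (hmem x hx i)]; rfl
  have hX's : ∀ i, IsSmoothFieldOn (fun x => ((X' i x : E) : TangentSpace 𝓘(ℝ, E) x)) U :=
    fun i => (hXs i).congr fun x hx =>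
      congrArg (fun v : TangentSpace 𝓘(ℝ, E) x => (⟨x, v⟩ : TangentBundle 𝓘(ℝ, E) M))
        (hX' x hx i)
  have hli : ∀ x ∈ U, LinearIndependent ℝ (fun i => X' i x) := fun x hx => by
    refine LinearIndependent.of_comp (g.plane x).subtype ?_
    have : ((g.plane x).subtype ∘ fun i => X' i x) = fun i => X i x :=
      funext fun i => hX' x hx i
    rw [this]; exact (hX x hx).1
  have hsp : ∀ x ∈ U, Submodule.span ℝ (range fun i => X' i x) = ⊤ := fun x hx => by
    apply Submodule.map_injective_of_injective (g.plane x).injective_subtype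
    rw [Submodule.map_span, Submodule.map_top, Submodule.range_subtype, ← range_comp]
    have : ((g.plane x).subtype ∘ fun i => X' i x) = fun i => X i x :=
      funext fun i => hX' x hx i
    rw [this]; exact (hX x hx).2
  have hxi : ∀ i, ContDiffOn ℝ ∞
      (fun y => mdiff (E := E) (E' := E) e (e.symm y) (X' i (e.symm y))) O :=
    fun i => (hX's i).contDiffOn_chart he
  have hgr : ∀ i j, ContDiffOn ℝ ∞
      (fun y => g.form (e.symm y) (X' i (e.symm y)) (X' j (e.symm y))) O := fun i j =>
    ((g.smooth_inner U hU (X' i) (X' j) (hX's i) (hX's j)).comp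
      ((contMDiffOn_symm_of_mem_maximalAtlas he).mono inter_subset_left)
      inter_subset_right).contDiffOn
  have hform : ∀ y ∈ O, g.chartCometric e y =
      combMap (fun i => mdiff (E := E) (E' := E) e (e.symm y) (X' i (e.symm y))) ∘L
      (gramMap fun i j => g.form (e.symm y) (X' i (e.symm y)) (X' j (e.symm y))).inverse ∘L
      evalMap (fun i => mdiff (E := E) (E' := E) e (e.symm y) (X' i (e.symm y))) := by
    intro y hy
    ext p
    rw [chartCometric_apply, g.sharpMap_eq_frame _ _ (hli _ hy.2) (hsp _ hy.2)]
    simp only [ContinuousLinearMap.comp_apply, combMap_apply, map_sum, map_smul]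
    rfl
  have hinv : ContDiffAt ℝ ∞ (fun y =>
      (gramMap fun i j => g.form (e.symm y) (X' i (e.symm y)) (X' j (e.symm y))).inverse) y₀ :=
    ContDiffAt.comp y₀ (g := ContinuousLinearMap.inverse)
      (gramMap_isInvertible _ (g.form_pos _) (hli _ hxU)).contDiffAt_map_inverse
      ((ContDiffOn.gramMap hgr).contDiffAt (hOo.mem_nhds ⟨hy₀, hxU⟩))
  have hn := hOo.mem_nhds (⟨hy₀, hxU⟩ : y₀ ∈ O)
  refine ContDiffAt.contDiffWithinAt ?_
  refine ContDiffAt.congr_of_eventuallyEq ?_ (Filter.eventuallyEq_of_mem hn hform)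
  exact ((ContDiffOn.combMap hxi).contDiffAt hn).clm_comp
    (hinv.clm_comp ((ContDiffOn.evalMap hxi).contDiffAt hn))

end SubriemannianStructure

end Smooth

/-! ### Velocities of curves and their chart expressions -/

section Velocity

variable {E : Type*} [NormedAddCommGroup E] [NormedSpace ℝ E]
  {M : Type*} [TopologicalSpace M] [ChartedSpace E M]
  {E' : Type*} [NormedAddCommGroup E'] [NormedSpace ℝ E']
  {N : Type*} [TopologicalSpace N] [ChartedSpace E' N]

theorem HasVelocityWithinAt.continuousWithinAt {γ : ℝ → M} {s : Set ℝ} {t : ℝ} {v : E}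
    (h : HasVelocityWithinAt (E := E) γ s t v) : ContinuousWithinAt γ s t :=
  HasMFDerivWithinAt.continuousWithinAt h

theorem HasVelocityWithinAt.mono {γ : ℝ → M} {s s' : Set ℝ} {t : ℝ} {v : E}
    (h : HasVelocityWithinAt (E := E) γ s t v) (hs : s' ⊆ s) :
    HasVelocityWithinAt (E := E) γ s' t v :=
  HasMFDerivWithinAt.mono h hs

theorem HasVelocityWithinAt.mono_of_mem {γ : ℝ → M} {s s' : Set ℝ} {t : ℝ} {v : E}
    (h : HasVelocityWithinAt (E := E) γ s t v) (hs : s ∈ 𝓝[s'] t) :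
    HasVelocityWithinAt (E := E) γ s' t v :=
  HasMFDerivWithinAt.mono_of_mem_nhdsWithin h hs

theorem HasVelocityWithinAt.congr {γ γ' : ℝ → M} {s : Set ℝ} {t : ℝ} {v : E}
    (h : HasVelocityWithinAt (E := E) γ s t v) (hs : ∀ x ∈ s, γ' x = γ x) (ht : t ∈ s) :
    HasVelocityWithinAt (E := E) γ' s t v :=
  HasMFDerivWithinAt.congr_mono (f := γ) h hs (hs t ht) subset_rfl

theorem HasVelocityWithinAt.union {γ : ℝ → M} {s s' : Set ℝ} {t : ℝ} {v : E}
    (h : HasVelocityWithinAt (E := E) γ s t v) (h' : HasVelocityWithinAt (E := E) γ s' t v) :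
    HasVelocityWithinAt (E := E) γ (s ∪ s') t v :=
  HasMFDerivWithinAt.union h h'

theorem HasVelocityWithinAt.comp {γ : ℝ → M} {s : Set ℝ} {t : ℝ} {v : E}
    (h : HasVelocityWithinAt (E := E) γ s t v) {f : M → N}
    (hf : MDifferentiableAt 𝓘(ℝ, E) 𝓘(ℝ, E') f (γ t)) :
    HasVelocityWithinAt (E := E') (fun s => f (γ s)) s t (mdiff (E := E) (E' := E') f (γ t) v) := by
  have := hf.hasMFDerivAt.comp_hasMFDerivWithinAt t h
  refine (congrArg (HasMFDerivWithinAt 𝓘(ℝ, ℝ) 𝓘(ℝ, E') (f ∘ γ) s t) ?_).mp this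
  change (mdiff (E := E) (E' := E') f (γ t)).comp ((1 : ℝ →L[ℝ] ℝ).smulRight v) =
    (1 : ℝ →L[ℝ] ℝ).smulRight (mdiff (E := E) (E' := E') f (γ t) v)
  ext; simp

theorem hasVelocityWithinAt_iff_hasDerivWithinAt {y : ℝ → E} {s : Set ℝ} {t : ℝ} {v : E} :
    HasVelocityWithinAt (E := E) y s t v ↔ HasDerivWithinAt y v s t := by
  have : (ContinuousLinearMap.toSpanSingleton ℝ v) = (1 : ℝ →L[ℝ] ℝ).smulRight v := by
    ext; simp
  rw [hasDerivWithinAt_iff_hasFDerivWithinAt, this]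
  exact hasMFDerivWithinAt_iff_hasFDerivWithinAt (f' := (1 : ℝ →L[ℝ] ℝ).smulRight v)

theorem HasVelocityWithinAt.unique {γ : ℝ → M} {s : Set ℝ} {t : ℝ} {v w : E}
    (hs : UniqueDiffWithinAt ℝ s t)
    (h : HasVelocityWithinAt (E := E) γ s t v) (h' : HasVelocityWithinAt (E := E) γ s t w) :
    v = w := by
  have := (uniqueMDiffWithinAt_iff_uniqueDiffWithinAt.2 hs).eq h h'
  have h1 := congrArg (fun L : ℝ →L[ℝ] E => L 1) this
  simpa using (show (1 : ℝ →L[ℝ] ℝ) 1 • v = (1 : ℝ →L[ℝ] ℝ) 1 • w from h1)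

variable [IsManifold 𝓘(ℝ, E) ∞ M]

theorem hasVelocityWithinAt_iff_chart {γ : ℝ → M} {s : Set ℝ} {t : ℝ} {v : E}
    (hc : ContinuousWithinAt γ s t)
    {e : OpenPartialHomeomorph M E} (he : e ∈ IsManifold.maximalAtlas 𝓘(ℝ, E) ∞ M)
    (ht : γ t ∈ e.source) :
    HasVelocityWithinAt (E := E) γ s t v ↔
      HasDerivWithinAt (fun s => e (γ s)) (mdiff (E := E) (E' := E) e (γ t) v) s t := by
  have hd := mdifferentiable_of_mem_maximalAtlas he
  rw [← hasVelocityWithinAt_iff_hasDerivWithinAt]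
  refine ⟨fun h => h.comp (hd.mdifferentiableAt ht), fun h => ?_⟩
  have h2 := h.comp (f := e.symm) (hd.mdifferentiableAt_symm (e.map_source ht))
  have hv : mdiff (E := E) (E' := E) e.symm (e (γ t)) (mdiff (E := E) (E' := E) e (γ t) v) = v :=
    congrArg (fun L : E →L[ℝ] E => L v) (hd.symm_comp_deriv ht)
  rw [hv] at h2
  refine HasMFDerivWithinAt.congr_of_eventuallyEq (f := fun s => e.symm (e (γ s)))
    (f' := (1 : ℝ →L[ℝ] ℝ).smulRight v) h2 ?_ (e.left_inv ht).symm
  filter_upwards [hc (e.open_source.mem_nhds ht)] with x hx using (e.left_inv hx).symm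

end Velocity

/-! ### Covectors in charts -/

section Charts

variable {E : Type*} [NormedAddCommGroup E] [NormedSpace ℝ E]
  {M : Type*} [TopologicalSpace M] [ChartedSpace E M] [IsManifold 𝓘(ℝ, E) ∞ M]

/-- The coordinate expression of a covector, between model spaces. -/
def covec (e : OpenPartialHomeomorph M E) (x : M) (p : E →L[ℝ] ℝ) : E →L[ℝ] ℝ :=
  p ∘L (mdiff (E := E) (E' := E) e x).inverse

theorem mdiff_chart_isInvertible {e : OpenPartialHomeomorph M E}
    (he : e ∈ IsManifold.maximalAtlas 𝓘(ℝ, E) ∞ M) {x : M} (hx : x ∈ e.source) :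
    (mdiff (E := E) (E' := E) e x).IsInvertible :=
  ⟨(mdifferentiable_of_mem_maximalAtlas he).mfderiv hx, rfl⟩

theorem covec_comp_mdiff {e : OpenPartialHomeomorph M E}
    (he : e ∈ IsManifold.maximalAtlas 𝓘(ℝ, E) ∞ M) {x : M} (hx : x ∈ e.source)
    (p : E →L[ℝ] ℝ) : covec e x p ∘L mdiff (E := E) (E' := E) e x = p := by
  ext v
  simp [covec, (mdiff_chart_isInvertible he hx).inverse_apply_self]

end Charts

/-! ### Testing derivatives by linear forms; conservation of energy in coordinates -/

section Dual

variable {E : Type*} [NormedAddCommGroup E] [NormedSpace ℝ E] [FiniteDimensional ℝ E]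

theorem hasDerivWithinAt_iff_forall_dual {y : ℝ → E} {v : E} {s : Set ℝ} {t : ℝ} :
    HasDerivWithinAt y v s t ↔
      ∀ ξ : E →L[ℝ] ℝ, HasDerivWithinAt (fun s => ξ (y s)) (ξ v) s t := by
  refine ⟨fun h ξ => ξ.hasFDerivAt.comp_hasDerivWithinAt t h, fun h => ?_⟩
  let b := (Module.finBasis ℝ E).equivFunL
  have hb : HasDerivWithinAt (fun s => b (y s)) (b v) s t := by
    rw [hasDerivWithinAt_pi]
    exact fun i => h ((ContinuousLinearMap.proj i).comp b.toContinuousLinearMap)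
  have := b.symm.toContinuousLinearMap.hasFDerivAt.comp_hasDerivWithinAt t hb
  simpa [Function.comp_def] using this

/-- The derivative of the energy along a solution of Hamilton's equations vanishes. -/
theorem hasDerivWithinAt_energy {S : E → (E →L[ℝ] ℝ) →L[ℝ] E}
    (hsymm : ∀ (y : E) (p q : E →L[ℝ] ℝ), p (S y q) = q (S y p)) {y : ℝ → E} {p : ℝ → E →L[ℝ] ℝ} {I : Set ℝ} {t : ℝ}
    (hS : DifferentiableAt ℝ S (y t)) (hy : HasDerivWithinAt y (S (y t) (p t)) I t)
    (hp : HasDerivWithinAt p (-((1 / 2 : ℝ) • (p t ∘L (fderiv ℝ S (y t)).flip (p t)))) I t) :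
    HasDerivWithinAt (fun s => p s (S (y s) (p s))) 0 I t := by
  have h1 : HasDerivWithinAt (fun s => S (y s)) (fderiv ℝ S (y t) (S (y t) (p t))) I t :=
    HasFDerivAt.comp_hasDerivWithinAt (l := S) (l' := fderiv ℝ S (y t)) t hS.hasFDerivAt hy
  refine (hp.clm_apply (h1.clm_apply hp)).congr_deriv ?_
  -- The product rule gives `p'Sp + p(DS)p + pSp'`. By symmetry the outer terms agree, and each is
  -- `-½ p(DS)p` by the second Hamilton equation.
  rw [map_add, hsymm (y t) (p t)]
  simp only [neg_apply, smul_apply, ContinuousLinearMap.comp_apply,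
    ContinuousLinearMap.flip_apply, smul_eq_mul]
  ring

end Dual

/-! ### Hamilton's equations in terms of the cometric -/

section Hamilton

variable {E : Type*} [NormedAddCommGroup E] [NormedSpace ℝ E] [FiniteDimensional ℝ E]
  {M : Type*} [TopologicalSpace M] [ChartedSpace E M] [IsManifold 𝓘(ℝ, E) ∞ M]

namespace SubriemannianStructure

variable (g : SubriemannianStructure E M)

/-- The two halves of the derivative of `½ p(Sp)` coincide because `S` is symmetric. -/
theorem hasFDerivAt_chartHamiltonian_covector (e : OpenPartialHomeomorph M E) (y : E)
    (p : E →L[ℝ] ℝ) : HasFDerivAt (fun p => chartHamiltonian g.hamiltonian e y p)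
      (ContinuousLinearMap.apply ℝ ℝ (g.chartCometric e y p)) p := by
  simp only [chartHamiltonian_eq]
  have h := ((hasFDerivAt_id p).clm_apply (g.chartCometric e y).hasFDerivAt).const_mul (1 / 2 : ℝ)
  refine h.congr_fderiv ?_
  ext ξ
  simp [g.chartCometric_symm e y p ξ]
  ring

theorem hasFDerivAt_chartHamiltonian_point {e : OpenPartialHomeomorph M E}
    (he : e ∈ IsManifold.maximalAtlas 𝓘(ℝ, E) ∞ M) {y : E} (hy : y ∈ e.target)
    (p : E →L[ℝ] ℝ) : HasFDerivAt (fun y => chartHamiltonian g.hamiltonian e y p)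
      ((1 / 2 : ℝ) • (p ∘L (fderiv ℝ (g.chartCometric e) y).flip p)) y := by
  simp only [chartHamiltonian_eq]
  have h0 : HasFDerivAt (g.chartCometric e) (fderiv ℝ (g.chartCometric e) y) y :=
    (((g.contDiffOn_chartCometric he).contDiffAt (e.open_target.mem_nhds hy)).differentiableAt
      (by simp)).hasFDerivAt
  have h := (p.hasFDerivAt.comp y (h0.clm_apply (hasFDerivAt_const p y))).const_mul (1 / 2 : ℝ)
  refine h.congr_fderiv ?_
  ext η
  simp

/-- Hamilton's equations at the time `t` in the chart `e`, written with the cometric. -/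
def HamiltonEq (e : OpenPartialHomeomorph M E) (I : Set ℝ) (γ : ℝ → M) (α : ℝ → E →L[ℝ] ℝ)
    (t : ℝ) : Prop :=
  HasDerivWithinAt (fun s => e (γ s)) (g.chartCometric e (e (γ t)) (covec e (γ t) (α t))) I t ∧
  HasDerivWithinAt (fun s => covec e (γ s) (α s))
    (-((1 / 2 : ℝ) • (covec e (γ t) (α t) ∘L
      (fderiv ℝ (g.chartCometric e) (e (γ t))).flip (covec e (γ t) (α t))))) I t

/-- Evaluating the partial derivatives of the Hamiltonian turns the definition into an explicit
differential system, the form used everywhere below. -/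
theorem isHamiltonianTrajectory_iff {I : Set ℝ} {γ : ℝ → M} {α : ℝ → E →L[ℝ] ℝ} :
    IsHamiltonianTrajectory (E := E) g.hamiltonian I γ α ↔ ContinuousOn γ I ∧
      ∀ t ∈ I, ∀ e ∈ IsManifold.maximalAtlas 𝓘(ℝ, E) ∞ M, γ t ∈ e.source →
        g.HamiltonEq e I γ α t := by
  unfold IsHamiltonianTrajectory HamiltonEq
  refine and_congr_right fun _ => forall₂_congr fun t _ => forall₃_congr fun e he hs =>
    and_congr ?_ ?_
  · rw [hasDerivWithinAt_iff_forall_dual]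
    refine forall_congr' fun ξ => ?_
    have := (g.hasFDerivAt_chartHamiltonian_covector e (e (γ t)) (covec e (γ t) (α t))).fderiv
    exact iff_of_eq (congrArg (fun L : (E →L[ℝ] ℝ) →L[ℝ] ℝ =>
      HasDerivWithinAt (fun s => ξ (e (γ s))) (L ξ) I t) this)
  · have := (g.hasFDerivAt_chartHamiltonian_point he (e.map_source hs)
      (covec e (γ t) (α t))).fderiv
    exact iff_of_eq (congrArg (fun L : E →L[ℝ] ℝ =>
      HasDerivWithinAt (fun s => covec e (γ s) (α s)) (-L) I t) this)

theorem chartCometric_covec {e : OpenPartialHomeomorph M E}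
    (he : e ∈ IsManifold.maximalAtlas 𝓘(ℝ, E) ∞ M) {x : M} (hx : x ∈ e.source)
    (p : E →L[ℝ] ℝ) : g.chartCometric e (e x) (covec e x p) =
      mdiff (E := E) (E' := E) e x (g.sharpMap x p) := by
  rw [chartCometric_apply, e.left_inv hx, covec_comp_mdiff he hx]

theorem covec_chartCometric_covec {e : OpenPartialHomeomorph M E}
    (he : e ∈ IsManifold.maximalAtlas 𝓘(ℝ, E) ∞ M) {x : M} (hx : x ∈ e.source)
    (p : E →L[ℝ] ℝ) :
    covec e x p (g.chartCometric e (e x) (covec e x p)) = p (g.sharpMap x p) := by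
  rw [chartCometric_covec g he hx, ← ContinuousLinearMap.comp_apply, covec_comp_mdiff he hx]

/-- A Hamiltonian trajectory has velocity dual to its covector. -/
theorem hasVelocityWithinAt_of_trajectory {I : Set ℝ} {γ : ℝ → M} {α : ℝ → E →L[ℝ] ℝ}
    (h : IsHamiltonianTrajectory (E := E) g.hamiltonian I γ α) {t : ℝ} (ht : t ∈ I) :
    HasVelocityWithinAt (E := E) γ I t (g.sharpMap (γ t) (α t)) := by
  obtain ⟨hc, h⟩ := g.isHamiltonianTrajectory_iff.1 h
  have he := IsManifold.chart_mem_maximalAtlas (I := 𝓘(ℝ, E)) (n := ∞) (γ t)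
  have hs := mem_chart_source E (γ t)
  rw [hasVelocityWithinAt_iff_chart (hc t ht) he hs, ← chartCometric_covec g he hs]
  exact (h t ht _ he hs).1

/-- The energy is constant along Hamiltonian trajectories. -/
theorem energy_const {I : Set ℝ} (hI : I.OrdConnected) {γ : ℝ → M} {α : ℝ → E →L[ℝ] ℝ}
    (h : IsHamiltonianTrajectory (E := E) g.hamiltonian I γ α) {t t' : ℝ} (ht : t ∈ I)
    (ht' : t' ∈ I) :
    α t (g.sharpMap (γ t) (α t)) = α t' (g.sharpMap (γ t') (α t')) := by
  obtain ⟨hc, h⟩ := g.isHamiltonianTrajectory_iff.1 h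
  have key : ∀ t ∈ I, HasDerivWithinAt (fun s => α s (g.sharpMap (γ s) (α s))) 0 I t := by
    intro t ht
    have he := IsManifold.chart_mem_maximalAtlas (I := 𝓘(ℝ, E)) (n := ∞) (γ t)
    have hs := mem_chart_source E (γ t)
    obtain ⟨h1, h2⟩ := h t ht _ he hs
    set e := chartAt E (γ t)
    have h0 : DifferentiableAt ℝ (g.chartCometric e) (e (γ t)) :=
      ((g.contDiffOn_chartCometric he).contDiffAt
        (e.open_target.mem_nhds (e.map_source hs))).differentiableAt (by simp)
    have h4 := hasDerivWithinAt_energy (g.chartCometric_symm e) (y := fun s => e (γ s))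
      (p := fun s => covec e (γ s) (α s)) h0 h1 h2
    refine h4.congr_of_eventuallyEq ?_ (covec_chartCometric_covec g he hs _).symm
    filter_upwards [hc t ht (e.open_source.mem_nhds hs)] with s hs
    exact (covec_chartCometric_covec g he hs _).symm
  refine hI.convex.is_const_of_fderivWithin_eq_zero (𝕜 := ℝ)
    (f := fun s => α s (g.sharpMap (γ s) (α s)))
    (fun t ht => (key t ht).differentiableWithinAt) (fun t ht => ?_) ht ht'
  -- If derivatives within `I` are not unique at `t`, as for a one-point interval, `fderivWithin` is
  -- zero by convention.
  by_cases hu : UniqueDiffWithinAt ℝ I t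
  · rw [(key t ht).hasFDerivWithinAt.fderivWithin hu]; ext; simp
  · exact fderivWithin_zero_of_not_uniqueDiffWithinAt hu

end SubriemannianStructure

end Hamilton

/-! ### Trajectories depend only on restrictions to the interval -/

section Congr

variable {E : Type*} [NormedAddCommGroup E] [NormedSpace ℝ E]
  {M : Type*} [TopologicalSpace M] [ChartedSpace E M]

/-- Trajectories depend only on the restrictions of the curve and of the covectors to the
interval. -/
theorem IsHamiltonianTrajectory.congr {H : ∀ x : M, (TangentSpace 𝓘(ℝ, E) x →L[ℝ] ℝ) → ℝ}
    {I : Set ℝ} {γ γ' : ℝ → M} {α : ℝ → E →L[ℝ] ℝ}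
    (h : IsHamiltonianTrajectory (E := E) H I γ α) (hγ : EqOn γ' γ I) :
    IsHamiltonianTrajectory (E := E) H I γ' α := by
  refine ⟨h.1.congr hγ, fun t ht e he hs => ?_⟩
  have key := h.2 t ht e he (hγ ht ▸ hs)
  have h1 : ∀ s ∈ I, e (γ' s) = e (γ s) := fun s hs => by rw [hγ hs]
  have h2 : ∀ s ∈ I, covec e (γ' s) (α s) = covec e (γ s) (α s) := fun s hs => by rw [hγ hs]
  have h3 : chartCovector (E := E) e (γ' t) (α t) = chartCovector (E := E) e (γ t) (α t) := h2 t ht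
  rw [h1 t ht, h3]
  refine ⟨fun ξ => (key.1 ξ).congr (fun s hs => by rw [h1 s hs]) (by rw [h1 t ht]),
    key.2.congr h2 (h2 t ht)⟩

end Congr

/-! ### Riemannian metrics as subriemannian structures -/

section Riemannian

variable {E : Type*} [NormedAddCommGroup E] [NormedSpace ℝ E] [FiniteDimensional ℝ E]
  {M : Type*} [TopologicalSpace M] [ChartedSpace E M] [IsManifold 𝓘(ℝ, E) ∞ M]

/-- A trivialization of the tangent bundle carries a basis of the model space to a smooth local
frame. -/
theorem isSmoothDistribution_top :
    IsSmoothDistribution (fun x : M => (⊤ : Submodule ℝ (TangentSpace 𝓘(ℝ, E) x))) := by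
  intro x₀
  let e := trivializationAt E (TangentSpace 𝓘(ℝ, E) : M → Type _) x₀
  refine ⟨e.baseSet, e.open_baseSet, FiberBundle.mem_baseSet_trivializationAt' x₀, _,
    e.localFrame (Module.finBasis ℝ E), fun i => ?_, fun x hx => ?_⟩
  · exact e.contMDiffOn_localFrame_baseSet (I := 𝓘(ℝ, E)) ∞ (Module.finBasis ℝ E) i
  · have h := e.isLocalFrameOn_localFrame_baseSet 𝓘(ℝ, E) ∞ (Module.finBasis ℝ E)
    exact ⟨h.linearIndependent hx, top_le_iff.1 (h.generating hx)⟩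

/-- A Riemannian metric, as a subriemannian structure. -/
def RiemannianMetric.toSub (g : RiemannianMetric E M) : SubriemannianStructure E M where
  dist _ := ⊤
  smooth_dist := isSmoothDistribution_top
  inner x := (RiemannianMetric.bilin g x).restrict ⊤
  symm x v w := g.symm x v w
  pos x v hv := g.pos x v (fun h => hv (Subtype.ext h))
  smooth_inner U _ X Y hX hY := by
    intro x hx
    have : ContMDiffWithinAt 𝓘(ℝ, E) (𝓘(ℝ, E).prod 𝓘(ℝ)) ∞
        (fun m ↦ Bundle.TotalSpace.mk' ℝ (E := Bundle.Trivial M ℝ) m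
          (g.inner m (X m) (Y m))) U x := by
      apply ContMDiffWithinAt.clm_bundle_apply₂ (F₁ := E) (F₂ := E)
      · exact g.contMDiff.contMDiffAt.contMDiffWithinAt
      · exact hX x hx
      · exact hY x hx
    simp only [Bundle.contMDiffWithinAt_totalSpace] at this
    exact this.2

theorem RiemannianMetric.hamiltonian_toSub (g : RiemannianMetric E M) :
    (RiemannianMetric.toSub g).hamiltonian = RiemannianMetric.hamiltonian g := by
  funext x β
  let V := riesz (RiemannianMetric.bilin g x) (fun v hv => g.pos x v hv) β.toLinearMap
  have : (⟨V, trivial⟩ : (RiemannianMetric.toSub g).plane x) =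
      (RiemannianMetric.toSub g).planeSharp x β :=
    (RiemannianMetric.toSub g).eq_planeSharp fun u =>
      riesz_spec (RiemannianMetric.bilin g x) (fun v hv => g.pos x v hv) β.toLinearMap (u : E)
  change (1 / 2 : ℝ) * (RiemannianMetric.toSub g).form x _ _ = _
  rw [show (RiemannianMetric.toSub g).sharp x β = (RiemannianMetric.toSub g).planeSharp x β
    from rfl, ← this]
  rfl

end Riemannian

/-! ### Controlled differential equations on intervals -/

section ODE

/-- A point of an interval has, within the interval, arbitrarily small compact neighbourhoods that
are intervals. -/
theorem exists_Icc_mem_nhdsWithin {I : Set ℝ} (hI : I.OrdConnected) {t₀ : ℝ} (ht₀ : t₀ ∈ I)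
    {N : Set ℝ} (hN : N ∈ 𝓝[I] t₀) :
    ∃ a b, t₀ ∈ Icc a b ∧ Icc a b ⊆ I ∧ Icc a b ⊆ N ∧ Icc a b ∈ 𝓝[I] t₀ := by
  obtain ⟨ε, hε, hball⟩ := Metric.mem_nhdsWithin_iff.1 hN
  -- If `I` has no points to the right of `t₀`, then `t₀` itself serves as right end point; likewise
  -- on the left.
  have hr : ∃ b, t₀ ≤ b ∧ b < t₀ + ε ∧ b ∈ I ∧ ∀ᶠ s in 𝓝[I] t₀, s ≤ b := by
    by_cases h : ∃ b ∈ I, t₀ < b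
    · obtain ⟨b, hb, hlt⟩ := h
      refine ⟨min b (t₀ + ε / 2), by grind, by grind, hI.out ht₀ hb ⟨by grind, by grind⟩, ?_⟩
      exact mem_nhdsWithin_of_mem_nhds (Iic_mem_nhds (by grind))
    · push Not at h
      exact ⟨t₀, le_rfl, by linarith, ht₀, by filter_upwards [self_mem_nhdsWithin] using h⟩
  have hl : ∃ a, a ≤ t₀ ∧ t₀ - ε < a ∧ a ∈ I ∧ ∀ᶠ s in 𝓝[I] t₀, a ≤ s := by
    by_cases h : ∃ a ∈ I, a < t₀
    · obtain ⟨a, ha, hlt⟩ := h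
      refine ⟨max a (t₀ - ε / 2), by grind, by grind, hI.out ha ht₀ ⟨by grind, by grind⟩, ?_⟩
      exact mem_nhdsWithin_of_mem_nhds (Ici_mem_nhds (by grind))
    · push Not at h
      exact ⟨t₀, le_rfl, by linarith, ht₀, by filter_upwards [self_mem_nhdsWithin] using h⟩
  obtain ⟨b, hb1, hb2, hb3, hb4⟩ := hr
  obtain ⟨a, ha1, ha2, ha3, ha4⟩ := hl
  have hsub : Icc a b ⊆ I := hI.out ha3 hb3
  refine ⟨a, b, ⟨ha1, hb1⟩, hsub, fun s hs => hball ⟨?_, hsub hs⟩, ?_⟩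
  · rw [Real.ball_eq_Ioo]; exact ⟨by linarith [hs.1], by linarith [hs.2]⟩
  · filter_upwards [ha4, hb4] with s h1 h2 using ⟨h1, h2⟩

variable {E : Type*} [NormedAddCommGroup E] [NormedSpace ℝ E]
  {W : Type*} [NormedAddCommGroup W] [NormedSpace ℝ W]

/-- Local uniqueness for the equation `y' = A(y) w(t)` on an interval. -/
theorem eventually_eq_of_controlled_ode {A : E → W →L[ℝ] E} {w : ℝ → W} {I : Set ℝ}
    (hI : I.OrdConnected) {t₀ : ℝ} (ht₀ : t₀ ∈ I) (hw : ContinuousWithinAt w I t₀)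
    {y₁ y₂ : ℝ → E} (hA : ContDiffAt ℝ 1 A (y₁ t₀))
    (h₁ : ∀ᶠ s in 𝓝[I] t₀, HasDerivWithinAt y₁ (A (y₁ s) (w s)) I s)
    (h₂ : ∀ᶠ s in 𝓝[I] t₀, HasDerivWithinAt y₂ (A (y₂ s) (w s)) I s)
    (h : y₁ t₀ = y₂ t₀) : ∀ᶠ s in 𝓝[I] t₀, y₁ s = y₂ s := by
  -- `A` is Lipschitz near the starting point and `w` is bounded near `t₀`, so `y ↦ A(y) w(t)` is
  -- Lipschitz uniformly in `t`; Grönwall uniqueness is then applied on each side of `t₀`.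
  obtain ⟨K, U, hU, hK⟩ := hA.exists_lipschitzOnWith
  have hy₁ := (h₁.self_of_nhdsWithin ht₀).continuousWithinAt
  have hy₂ := (h₂.self_of_nhdsWithin ht₀).continuousWithinAt
  have hwb : ∀ᶠ s in 𝓝[I] t₀, ‖w s‖ < ‖w t₀‖ + 1 :=
    hw.norm.eventually (gt_mem_nhds (lt_add_one _))
  obtain ⟨a, b, htab, habI, hab, hnhd⟩ := exists_Icc_mem_nhdsWithin hI ht₀
    (((h₁.and h₂).and ((hy₁.eventually hU).and (hy₂.eventually (h ▸ hU)))).and hwb)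
  set C : NNReal := ⟨‖w t₀‖ + 1, by positivity⟩ with hC
  have hlip : ∀ s ∈ Icc a b, LipschitzOnWith (K * C) (fun y => A y (w s)) U := by
    intro s hs
    refine LipschitzOnWith.of_dist_le_mul fun x hx y hy => ?_
    rw [dist_eq_norm, ← sub_apply]
    have h1 := hK.dist_le_mul x hx y hy
    rw [dist_eq_norm] at h1
    calc ‖(A x - A y) (w s)‖ ≤ ‖A x - A y‖ * ‖w s‖ := (A x - A y).le_opNorm _
      _ ≤ (K * dist x y) * C := by
        have : ‖w s‖ ≤ C := (hab hs).2.le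
        gcongr
      _ = _ := by push_cast; ring
  have hcont : ∀ y : ℝ → E, (∀ s ∈ Icc a b, HasDerivWithinAt y (A (y s) (w s)) I s) →
      ContinuousOn y (Icc a b) := fun y hy s hs => ((hy s hs).continuousWithinAt).mono habI
  have hc₁ := hcont y₁ fun s hs => (hab hs).1.1.1
  have hc₂ := hcont y₂ fun s hs => (hab hs).1.1.2
  filter_upwards [hnhd] with s hs
  rcases le_total t₀ s with hle | hle
  · have hsub : Icc t₀ s ⊆ Icc a b := Icc_subset_Icc htab.1 hs.2
    have hI' : ∀ t ∈ Ico t₀ s, I ∈ 𝓝[Ici t] t := fun t ht =>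
      Filter.mem_of_superset (Icc_mem_nhdsGE ht.2) fun x hx =>
        habI (hsub ⟨ht.1.trans hx.1, hx.2⟩)
    have hm : ∀ t ∈ Ico t₀ s, t ∈ Icc a b := fun t ht => hsub (Ico_subset_Icc_self ht)
    exact ODE_solution_unique_of_mem_Icc_right (v := fun t y => A y (w t)) (s := fun _ => U)
      (fun t ht => hlip t (hm t ht)) (hc₁.mono hsub)
      (fun t ht => (hab (hm t ht)).1.1.1.mono_of_mem_nhdsWithin (hI' t ht))
      (fun t ht => (hab (hm t ht)).1.2.1) (hc₂.mono hsub)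
      (fun t ht => (hab (hm t ht)).1.1.2.mono_of_mem_nhdsWithin (hI' t ht))
      (fun t ht => (hab (hm t ht)).1.2.2) h ⟨hle, le_rfl⟩
  · have hsub : Icc s t₀ ⊆ Icc a b := Icc_subset_Icc hs.1 htab.2
    have hI' : ∀ t ∈ Ioc s t₀, I ∈ 𝓝[Iic t] t := fun t ht =>
      Filter.mem_of_superset (Icc_mem_nhdsLE ht.1) fun x hx =>
        habI (hsub ⟨hx.1, hx.2.trans ht.2⟩)
    have hm : ∀ t ∈ Ioc s t₀, t ∈ Icc a b := fun t ht => hsub (Ioc_subset_Icc_self ht)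
    exact ODE_solution_unique_of_mem_Icc_left (v := fun t y => A y (w t)) (s := fun _ => U)
      (fun t ht => hlip t (hm t ht)) (hc₁.mono hsub)
      (fun t ht => (hab (hm t ht)).1.1.1.mono_of_mem_nhdsWithin (hI' t ht))
      (fun t ht => (hab (hm t ht)).1.2.1) (hc₂.mono hsub)
      (fun t ht => (hab (hm t ht)).1.1.2.mono_of_mem_nhdsWithin (hI' t ht))
      (fun t ht => (hab (hm t ht)).1.2.2) h ⟨le_rfl, hle⟩

/-- Picard–Lindelöf, for a control that is continuous on the whole line. -/
theorem exists_solution_of_continuous_control [CompleteSpace E] {A : E → W →L[ℝ] E} {w : ℝ → W}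
    (hw : Continuous w) (t₀ : ℝ) {y₀ : E} (hA : ContDiffAt ℝ 1 A y₀) :
    ∃ y : ℝ → E, y t₀ = y₀ ∧ ∀ᶠ s in 𝓝 t₀, HasDerivAt y (A (y s) (w s)) s := by
  obtain ⟨K, U, hU, hK⟩ := hA.exists_lipschitzOnWith
  have hAb : ∀ᶠ y in 𝓝 y₀, ‖A y‖ < ‖A y₀‖ + 1 :=
    hA.continuousAt.norm.eventually (gt_mem_nhds (lt_add_one _))
  obtain ⟨a, ha, hball⟩ := Metric.nhds_basis_closedBall.mem_iff.1 (Filter.inter_mem hU hAb)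
  obtain ⟨C, hC⟩ := (isCompact_Icc (a := t₀ - 1) (b := t₀ + 1)).exists_bound_of_continuousOn
    hw.continuousOn
  have hC0 : 0 ≤ C := (norm_nonneg _).trans (hC t₀ ⟨by linarith, by linarith⟩)
  set L : ℝ := (‖A y₀‖ + 1) * C with hL
  have hL0 : 0 ≤ L := by positivity
  -- The bound `1` keeps the times where `C` bounds `w`; the other gives `L δ ≤ a`, so solutions
  -- stay in the ball. The denominator is `L + 1` because `L` may be zero.
  set δ : ℝ := min 1 (a / (L + 1)) with hδ
  have hδ0 : 0 < δ := lt_min one_pos (by positivity)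
  have hsub : Icc (t₀ - δ) (t₀ + δ) ⊆ Icc (t₀ - 1) (t₀ + 1) :=
    Icc_subset_Icc (by linarith [min_le_left 1 (a / (L + 1))])
      (by linarith [min_le_left 1 (a / (L + 1))])
  have hPL : IsPicardLindelof (fun t y => A y (w t))
      (⟨t₀, by constructor <;> linarith⟩ : Icc (t₀ - δ) (t₀ + δ)) y₀ ⟨a, ha.le⟩ 0 ⟨L, hL0⟩
      (K * ⟨C, hC0⟩) := by
    refine ⟨fun t ht => LipschitzOnWith.of_dist_le_mul fun x hx y hy => ?_,
      fun x _ => ((A x).continuous.comp hw).continuousOn, fun t ht x hx => ?_, ?_⟩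
    · rw [dist_eq_norm, ← sub_apply]
      have h1 := hK.dist_le_mul x (hball hx).1 y (hball hy).1
      rw [dist_eq_norm] at h1
      calc ‖(A x - A y) (w t)‖ ≤ ‖A x - A y‖ * ‖w t‖ := (A x - A y).le_opNorm _
        _ ≤ (K * dist x y) * C := by
          have := hC t (hsub ht)
          gcongr
        _ = K * C * dist x y := by ring
    · calc ‖A x (w t)‖ ≤ ‖A x‖ * ‖w t‖ := (A x).le_opNorm _
        _ ≤ (‖A y₀‖ + 1) * C := by
          have := hC t (hsub ht)
          have h2 : ‖A x‖ < ‖A y₀‖ + 1 := (hball hx).2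
          gcongr
    · have : L * δ ≤ a := by
        calc L * δ ≤ (L + 1) * (a / (L + 1)) := by
              gcongr
              · linarith
              · exact min_le_right _ _
          _ = a := by field_simp
      change L * max (t₀ + δ - t₀) (t₀ - (t₀ - δ)) ≤ a - 0
      simpa using this
  obtain ⟨y, hy0, hy⟩ := hPL.exists_eq_forall_mem_Icc_hasDerivWithinAt₀
  refine ⟨y, hy0, ?_⟩
  filter_upwards [Ioo_mem_nhds (show t₀ - δ < t₀ by linarith) (show t₀ < t₀ + δ by linarith)]
    with s hs
  exact (hy s (Ioo_subset_Icc_self hs)).hasDerivAt (Icc_mem_nhds hs.1 hs.2)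

/-- Local existence for the equation `y' = A(y) w(t)` on an interval. -/
theorem exists_controlled_ode [CompleteSpace E] {A : E → W →L[ℝ] E} {w : ℝ → W} {I : Set ℝ}
    (hI : I.OrdConnected) {t₀ : ℝ} (ht₀ : t₀ ∈ I)
    (hw : ∀ᶠ s in 𝓝[I] t₀, ContinuousWithinAt w I s) {y₀ : E} (hA : ContDiffAt ℝ 1 A y₀) :
    ∃ y : ℝ → E, y t₀ = y₀ ∧ ∀ᶠ s in 𝓝[I] t₀, HasDerivWithinAt y (A (y s) (w s)) I s := by
  obtain ⟨a, b, htab, habI, hab, hnhd⟩ := exists_Icc_mem_nhdsWithin hI ht₀ hw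
  have hle := htab.1.trans htab.2
  have hwc : ContinuousOn w (Icc a b) := fun s hs => (hab hs).mono habI
  -- The control is extended by constants beyond the compact interval; the solution is used only
  -- within it.
  obtain ⟨y, hy0, hy⟩ := exists_solution_of_continuous_control
    (w := IccExtend hle ((Icc a b).domRestrict w))
    (continuousOn_iff_continuous_domRestrict.1 hwc).Icc_extend' t₀ hA
  refine ⟨y, hy0, ?_⟩
  filter_upwards [mem_nhdsWithin_of_mem_nhds hy, hnhd] with s h1 h2
  rw [IccExtend_of_mem _ _ h2] at h1
  exact h1.hasDerivWithinAt

end ODE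

/-! ### Linear algebra of the submersion and its chart expression -/

section Submersion

variable {EQ : Type*} [NormedAddCommGroup EQ] [NormedSpace ℝ EQ] [FiniteDimensional ℝ EQ]
  {Q : Type*} [TopologicalSpace Q] [ChartedSpace EQ Q] [IsManifold 𝓘(ℝ, EQ) ∞ Q]
  {EB : Type*} [NormedAddCommGroup EB] [NormedSpace ℝ EB] [FiniteDimensional ℝ EB]
  {B : Type*} [TopologicalSpace B] [ChartedSpace EB B] [IsManifold 𝓘(ℝ, EB) ∞ B]
  {π : Q → B} {gQ : SubriemannianStructure EQ Q} {gB : RiemannianMetric EB B}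
  {hor : ∀ q : Q, Submodule ℝ (TangentSpace 𝓘(ℝ, EQ) q)}

open SubriemannianStructure

namespace IsSubriemannianSubmersion

theorem form_eq_zero (h : IsSubriemannianSubmersion π gQ gB hor) {q : Q} {v w : gQ.plane q}
    (hv : (v : EQ) ∈ hor q) (hw : mdiff (E := EQ) (E' := EB) π q w = 0) : gQ.form q v w = 0 :=
  h.orthogonal q v w hv hw

theorem form_eq (h : IsSubriemannianSubmersion π gQ gB hor) {q : Q} {v w : gQ.plane q}
    (hv : (v : EQ) ∈ hor q) (hw : (w : EQ) ∈ hor q) :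
    gQ.form q v w = (RiemannianMetric.toSub gB).form (π q)
      ⟨mdiff (E := EQ) (E' := EB) π q v, trivial⟩ ⟨mdiff (E := EQ) (E' := EB) π q w, trivial⟩ :=
  (h.isometric q v w hv hw).symm

theorem exists_hor (h : IsSubriemannianSubmersion π gQ gB hor) (q : Q) (u : EB) :
    ∃ v : gQ.plane q, (v : EQ) ∈ hor q ∧ mdiff (E := EQ) (E' := EB) π q v = u :=
  let ⟨v, hv, hu⟩ := h.surjective q u
  ⟨⟨v, h.hor_le q hv⟩, hv, hu⟩

/-- The vector dual to a pulled back covector is the horizontal lift of the vector dual to the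
covector. -/
theorem sharpMap_pullback (h : IsSubriemannianSubmersion π gQ gB hor) (q : Q) (β : EB →L[ℝ] ℝ) :
    gQ.sharpMap q (β ∘L mdiff π q) ∈ hor q ∧
      mdiff (E := EQ) (E' := EB) π q (gQ.sharpMap q (β ∘L mdiff π q)) =
        (RiemannianMetric.toSub gB).sharpMap (π q) β := by
  obtain ⟨v, hv, hP⟩ := h.exists_hor q ((RiemannianMetric.toSub gB).sharpMap (π q) β)
  have key : v = gQ.planeSharp q (β ∘L mdiff π q) := by
    apply gQ.eq_planeSharp
    intro u
    -- Replacing `u` by the horizontal vector `u'` with the same projection changes it by a vertical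
    -- vector, which is orthogonal to `v`.
    obtain ⟨u', hu', hPu⟩ := h.exists_hor q (mdiff (E := EQ) (E' := EB) π q u)
    have h0 : gQ.form q v (u - u') = 0 := h.form_eq_zero hv (by simp [hPu])
    rw [map_sub, sub_eq_zero] at h0
    rw [h0, h.form_eq hv hu']
    have := (RiemannianMetric.toSub gB).form_planeSharp (π q) β
      ⟨mdiff (E := EQ) (E' := EB) π q u, trivial⟩
    simp only [hP, hPu]
    exact this
  rw [sharpMap_apply, ← key]
  exact ⟨hv, hP⟩

theorem form_planeSharp_pullback (h : IsSubriemannianSubmersion π gQ gB hor) (q : Q)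
    (β : EB →L[ℝ] ℝ) : gQ.form q (gQ.planeSharp q (β ∘L mdiff π q))
      (gQ.planeSharp q (β ∘L mdiff π q)) =
        β ((RiemannianMetric.toSub gB).sharpMap (π q) β) := by
  rw [form_planeSharp, ← sharpMap_apply, ContinuousLinearMap.comp_apply,
    (h.sharpMap_pullback q β).2]

/-- Among the vectors of the distribution over a given vector, the horizontal one is characterized
by its length. -/
theorem eq_sharpMap_of_form_eq (h : IsSubriemannianSubmersion π gQ gB hor) {q : Q}
    {β : EB →L[ℝ] ℝ} {v : gQ.plane q}
    (hv : mdiff (E := EQ) (E' := EB) π q v = (RiemannianMetric.toSub gB).sharpMap (π q) β)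
    (hf : gQ.form q v v = β ((RiemannianMetric.toSub gB).sharpMap (π q) β)) :
    (v : EQ) = gQ.sharpMap q (β ∘L mdiff π q) := by
  set u := gQ.planeSharp q (β ∘L mdiff π q) with hu
  have huh := h.sharpMap_pullback q β
  have h0 : gQ.form q u (v - u) = 0 := by
    refine h.form_eq_zero huh.1 ?_
    rw [Submodule.coe_sub, map_sub, hv, hu, ← sharpMap_apply, huh.2, sub_self]
  -- Pythagoras: `u` is orthogonal to `v - u`, and `u` and `v` have equal length.
  have h1 : gQ.form q (v - u) (v - u) = 0 := by
    have h2 := h.form_planeSharp_pullback q β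
    rw [← hu] at h2
    have h3 := gQ.form_symm q u v
    simp only [map_sub, LinearMap.sub_apply] at h0 ⊢
    linarith
  have h2 : v - u = 0 := by
    by_contra hne
    exact (gQ.form_pos q _ hne).ne' h1
  rw [sharpMap_apply, sub_eq_zero.1 h2]

/-- The square length of a horizontal vector is that of its projection. -/
theorem form_self_eq_of_mem_hor (h : IsSubriemannianSubmersion π gQ gB hor) {q : Q}
    {β : EB →L[ℝ] ℝ} {v : gQ.plane q} (hvh : (v : EQ) ∈ hor q)
    (hv : mdiff (E := EQ) (E' := EB) π q v = (RiemannianMetric.toSub gB).sharpMap (π q) β) :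
    gQ.form q v v = β ((RiemannianMetric.toSub gB).sharpMap (π q) β) := by
  rw [h.form_eq hvh hvh]
  simp only [hv]
  exact (RiemannianMetric.toSub gB).form_planeSharp (π q) β
    ((RiemannianMetric.toSub gB).planeSharp (π q) β)

end IsSubriemannianSubmersion

/-! ### The submersion in charts -/

/-- The coordinate expression of a map in a pair of charts. -/
def chartMap (π : Q → B) (e : OpenPartialHomeomorph Q EQ) (ψ : OpenPartialHomeomorph B EB)
    (y : EQ) : EB := ψ (π (e.symm y))

/-- The domain of the coordinate expression of a map. -/
def chartDomain (π : Q → B) (e : OpenPartialHomeomorph Q EQ) (ψ : OpenPartialHomeomorph B EB) :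
    Set EQ := e.target ∩ e.symm ⁻¹' (π ⁻¹' ψ.source)

/-- The map that assigns to a covector at the image point the coordinate expression of the vector
dual to the pulled back covector. -/
def liftMap (gQ : SubriemannianStructure EQ Q) (π : Q → B) (e : OpenPartialHomeomorph Q EQ)
    (ψ : OpenPartialHomeomorph B EB) (y : EQ) : (EB →L[ℝ] ℝ) →L[ℝ] EQ :=
  gQ.chartCometric e y ∘L
    (ContinuousLinearMap.compL ℝ EQ EB ℝ).flip (fderiv ℝ (chartMap π e ψ) y)

theorem liftMap_apply (e : OpenPartialHomeomorph Q EQ)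
    (ψ : OpenPartialHomeomorph B EB) (y : EQ) (w : EB →L[ℝ] ℝ) :
    liftMap gQ π e ψ y w = gQ.chartCometric e y (w ∘L fderiv ℝ (chartMap π e ψ) y) := rfl

section

variable {e : OpenPartialHomeomorph Q EQ} {ψ : OpenPartialHomeomorph B EB}

theorem isOpen_chartDomain (hπ : Continuous π) : IsOpen (chartDomain π e ψ) :=
  e.isOpen_inter_preimage_symm (ψ.open_source.preimage hπ)

theorem mem_chartDomain {x : Q} (hx : x ∈ e.source) (hπx : π x ∈ ψ.source) :
    e x ∈ chartDomain π e ψ :=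
  ⟨e.map_source hx, by rw [mem_preimage, e.left_inv hx]; exact hπx⟩

variable (he : e ∈ IsManifold.maximalAtlas 𝓘(ℝ, EQ) ∞ Q)
  (hψ : ψ ∈ IsManifold.maximalAtlas 𝓘(ℝ, EB) ∞ B)
  (hπ : ContMDiff 𝓘(ℝ, EQ) 𝓘(ℝ, EB) ∞ π)
include he hψ hπ

theorem contDiffOn_chartMap : ContDiffOn ℝ ∞ (chartMap π e ψ) (chartDomain π e ψ) :=
  ((contMDiffOn_of_mem_maximalAtlas hψ).comp
    (hπ.comp_contMDiffOn ((contMDiffOn_symm_of_mem_maximalAtlas he).mono inter_subset_left))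
    inter_subset_right).contDiffOn

theorem contDiffAt_chartMap {y : EQ} (hy : y ∈ chartDomain π e ψ) :
    ContDiffAt ℝ ∞ (chartMap π e ψ) y :=
  (contDiffOn_chartMap he hψ hπ).contDiffAt ((isOpen_chartDomain hπ.continuous).mem_nhds hy)

theorem contDiffAt_liftMap {y : EQ} (hy : y ∈ chartDomain π e ψ) :
    ContDiffAt ℝ ∞ (liftMap gQ π e ψ) y := by
  have h1 : ContDiffAt ℝ ∞ (fderiv ℝ (chartMap π e ψ)) y :=
    (contDiffAt_chartMap he hψ hπ hy).fderiv_right (by simp)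
  have h2 : ContDiff ℝ ∞ fun L : EQ →L[ℝ] EB => (ContinuousLinearMap.compL ℝ EQ EB ℝ).flip L :=
    ContinuousLinearMap.contDiff _
  exact ((gQ.contDiffOn_chartCometric he).contDiffAt (e.open_target.mem_nhds hy.1)).clm_comp
    (h2.contDiffAt.comp y h1)

/-- The chain rule applied to both sides of `chartMap π e ψ ∘ e = ψ ∘ π`, which holds near `x`. -/
theorem fderiv_chartMap_comp {x : Q} (hx : x ∈ e.source) (hπx : π x ∈ ψ.source) :
    fderiv ℝ (chartMap π e ψ) (e x) ∘L mdiff (E := EQ) (E' := EQ) e x =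
      mdiff (E := EB) (E' := EB) ψ (π x) ∘L mdiff (E := EQ) (E' := EB) π x := by
  have hde := mdifferentiable_of_mem_maximalAtlas he
  have hdψ := mdifferentiable_of_mem_maximalAtlas hψ
  have h1 : mdiff (E := EQ) (E' := EB) (chartMap π e ψ ∘ e) x =
      mdiff (E := EQ) (E' := EB) (chartMap π e ψ) (e x) ∘L mdiff (E := EQ) (E' := EQ) e x :=
    mfderiv_comp x ((contDiffAt_chartMap he hψ hπ
      (mem_chartDomain hx hπx)).contMDiffAt.mdifferentiableAt (by simp))
      (hde.mdifferentiableAt hx)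
  have h2 : mdiff (E := EQ) (E' := EB) (ψ ∘ π) x =
      mdiff (E := EB) (E' := EB) ψ (π x) ∘L mdiff (E := EQ) (E' := EB) π x :=
    mfderiv_comp x (hdψ.mdifferentiableAt hπx) (hπ.contMDiffAt.mdifferentiableAt (by simp))
  have h3 : mdiff (E := EQ) (E' := EB) (chartMap π e ψ ∘ e) x =
      mdiff (E := EQ) (E' := EB) (ψ ∘ π) x := by
    refine Filter.EventuallyEq.mfderiv_eq ?_
    filter_upwards [e.open_source.mem_nhds hx] with z hz
    simp [chartMap, e.left_inv hz]
  have h4 : mdiff (E := EQ) (E' := EB) (chartMap π e ψ) (e x) =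
      fderiv ℝ (chartMap π e ψ) (e x) := mfderiv_eq_fderiv
  rw [← h4, ← h1, h3, h2]

theorem covec_pullback {x : Q} (hx : x ∈ e.source) (hπx : π x ∈ ψ.source) (β : EB →L[ℝ] ℝ) :
    covec e x (β ∘L mdiff π x) = covec ψ (π x) β ∘L fderiv ℝ (chartMap π e ψ) (e x) := by
  have h1 : (covec ψ (π x) β ∘L fderiv ℝ (chartMap π e ψ) (e x)) ∘L
      mdiff (E := EQ) (E' := EQ) e x = β ∘L mdiff π x := by
    rw [ContinuousLinearMap.comp_assoc, fderiv_chartMap_comp he hψ hπ hx hπx,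
      ← ContinuousLinearMap.comp_assoc, covec_comp_mdiff hψ hπx]
  rw [← h1]
  ext v
  simp [covec, (mdiff_chart_isInvertible he hx).self_apply_inverse]

theorem liftMap_covec {x : Q} (hx : x ∈ e.source) (hπx : π x ∈ ψ.source) (β : EB →L[ℝ] ℝ) :
    liftMap gQ π e ψ (e x) (covec ψ (π x) β) =
      mdiff (E := EQ) (E' := EQ) e x (gQ.sharpMap x (β ∘L mdiff π x)) := by
  rw [liftMap_apply, ← covec_pullback he hψ hπ hx hπx, chartCometric_covec gQ he hx]

/-- This is `dπ ∘ S ∘ dπ* = T` in coordinates. It makes solutions of the lift equation project to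
solutions of the base equation, and its derivative yields the second Hamilton equation. -/
theorem fderiv_chartMap_liftMap (h : IsSubriemannianSubmersion π gQ gB hor) {y : EQ}
    (hy : y ∈ chartDomain π e ψ) (w : EB →L[ℝ] ℝ) :
    fderiv ℝ (chartMap π e ψ) y (liftMap gQ π e ψ y w) =
      (RiemannianMetric.toSub gB).chartCometric ψ (chartMap π e ψ y) w := by
  obtain ⟨x, hx, rfl⟩ : ∃ x ∈ e.source, e x = y :=
    ⟨e.symm y, e.map_target hy.1, e.right_inv hy.1⟩
  have hπx : π x ∈ ψ.source := by
    have := hy.2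
    rwa [mem_preimage, e.left_inv hx] at this
  -- Every coordinate covector comes from a covector at the point, as `dψ` is invertible.
  have hw : w = covec ψ (π x) (w ∘L mdiff ψ (π x)) := by
    ext v
    simp [covec, (mdiff_chart_isInvertible hψ hπx).self_apply_inverse]
  have hF : chartMap π e ψ (e x) = ψ (π x) := by simp [chartMap, e.left_inv hx]
  rw [hw, liftMap_covec he hψ hπ hx hπx, hF, chartCometric_covec _ hψ hπx,
    ← ContinuousLinearMap.comp_apply, fderiv_chartMap_comp he hψ hπ hx hπx,
    ContinuousLinearMap.comp_apply, (h.sharpMap_pullback x _).2]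

end

end Submersion

/-! ### The differentiated relation between the cometrics -/

section Pullback

variable {E : Type*} [NormedAddCommGroup E] [NormedSpace ℝ E]
  {E' : Type*} [NormedAddCommGroup E'] [NormedSpace ℝ E']

/-- Differentiation of the identity that relates two cometrics through a submersion. -/
theorem fderiv_cometric_of_submersion {F : E → E'} {S : E → (E →L[ℝ] ℝ) →L[ℝ] E}
    {T : E' → (E' →L[ℝ] ℝ) →L[ℝ] E'} {y : E} (hF : ContDiffAt ℝ 2 F y)
    (hS : DifferentiableAt ℝ S y) (hT : DifferentiableAt ℝ T (F y))
    (hsymm : ∀ (y : E) (p q : E →L[ℝ] ℝ), p (S y q) = q (S y p))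
    (hST : ∀ᶠ z in 𝓝 y, ∀ w : E' →L[ℝ] ℝ,
      fderiv ℝ F z (S z (w ∘L fderiv ℝ F z)) = T (F z) w) (w : E' →L[ℝ] ℝ) (η : E) :
    w (fderiv ℝ T (F y) (fderiv ℝ F y η) w) =
      2 * w (fderiv ℝ (fderiv ℝ F) y η (S y (w ∘L fderiv ℝ F y))) +
        w (fderiv ℝ F y (fderiv ℝ S y η (w ∘L fderiv ℝ F y))) := by
  have hF' : HasFDerivAt (fderiv ℝ F) (fderiv ℝ (fderiv ℝ F) y) y :=
    ((hF.fderiv_right (m := 1) (by norm_num)).differentiableAt (by simp)).hasFDerivAt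
  have hp : HasFDerivAt (fun z => w ∘L fderiv ℝ F z)
      ((ContinuousLinearMap.compL ℝ E E' ℝ w) ∘L fderiv ℝ (fderiv ℝ F) y) y :=
    (ContinuousLinearMap.compL ℝ E E' ℝ w).hasFDerivAt.comp y hF'
  have h1 := hp.clm_apply (hS.hasFDerivAt.clm_apply hp)
  have h2 : HasFDerivAt (fun z => T (F z)) (fderiv ℝ T (F y) ∘L fderiv ℝ F y) y :=
    HasFDerivAt.comp (g := T) (g' := fderiv ℝ T (F y)) y hT.hasFDerivAt
      (hF.differentiableAt (by simp)).hasFDerivAt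
  have h3 := w.hasFDerivAt.comp y (h2.clm_apply (hasFDerivAt_const w y))
  have h4 := h3.unique (h1.congr_of_eventuallyEq (by
    filter_upwards [hST] with z hz
    exact congrArg w (hz w).symm))
  have h5 := congrArg (fun L : E →L[ℝ] ℝ => L η) h4
  -- Both occurrences of `w ∘ F'` are differentiated; symmetry of `S` makes the two terms equal,
  -- whence the factor `2`.
  have h6 := hsymm y (w ∘L fderiv ℝ F y) (w ∘L fderiv ℝ (fderiv ℝ F) y η)
  simp at h5 h6
  rw [h5, h6]
  ring

end Pullback

/-! ### Horizontal lifts: local theory and normality -/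

section Lift

variable {EQ : Type*} [NormedAddCommGroup EQ] [NormedSpace ℝ EQ] [FiniteDimensional ℝ EQ]
  {Q : Type*} [TopologicalSpace Q] [ChartedSpace EQ Q] [IsManifold 𝓘(ℝ, EQ) ∞ Q]
  {EB : Type*} [NormedAddCommGroup EB] [NormedSpace ℝ EB] [FiniteDimensional ℝ EB]
  {B : Type*} [TopologicalSpace B] [ChartedSpace EB B] [IsManifold 𝓘(ℝ, EB) ∞ B]
  {π : Q → B} {gQ : SubriemannianStructure EQ Q} {gB : RiemannianMetric EB B}
  {hor : ∀ q : Q, Submodule ℝ (TangentSpace 𝓘(ℝ, EQ) q)}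

open SubriemannianStructure

/-- At the time `t`, the curve `σ` lies over `γ` and its velocity is dual to the pull back of the
covector `β t`. -/
def HorLiftAt (π : Q → B) (gQ : SubriemannianStructure EQ Q) (γ : ℝ → B) (β : ℝ → EB →L[ℝ] ℝ)
    (J : Set ℝ) (σ : ℝ → Q) (t : ℝ) : Prop :=
  π (σ t) = γ t ∧ HasVelocityWithinAt (E := EQ) σ J t (gQ.sharpMap (σ t) (β t ∘L mdiff π (σ t)))

/-- The curve `σ` is a horizontal lift of `γ` on `J`, where `β` is the covector dual to the velocity
of `γ`. -/
def IsHorLift (π : Q → B) (gQ : SubriemannianStructure EQ Q) (γ : ℝ → B) (β : ℝ → EB →L[ℝ] ℝ)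
    (J : Set ℝ) (σ : ℝ → Q) : Prop :=
  ∀ t ∈ J, HorLiftAt π gQ γ β J σ t

variable {γ : ℝ → B} {β : ℝ → EB →L[ℝ] ℝ} {I J : Set ℝ} {σ σ' : ℝ → Q}

theorem IsHorLift.mono {J' : Set ℝ} (h : IsHorLift π gQ γ β J σ) (hJ : J' ⊆ J) :
    IsHorLift π gQ γ β J' σ :=
  fun t ht => ⟨(h t (hJ ht)).1, (h t (hJ ht)).2.mono hJ⟩

theorem IsHorLift.continuousOn (h : IsHorLift π gQ γ β J σ) : ContinuousOn σ J :=
  fun t ht => (h t ht).2.continuousWithinAt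

theorem HorLiftAt.congr {t : ℝ} (h : HorLiftAt π gQ γ β J σ t) (hσ : EqOn σ' σ J) (ht : t ∈ J) :
    HorLiftAt π gQ γ β J σ' t := by
  refine ⟨by rw [hσ ht, h.1], ?_⟩
  rw [hσ ht]
  exact h.2.congr hσ ht

theorem HorLiftAt.mono_of_mem {J' : Set ℝ} {t : ℝ} (h : HorLiftAt π gQ γ β J σ t)
    (hJ : J ∈ 𝓝[J'] t) : HorLiftAt π gQ γ β J' σ t :=
  ⟨h.1, h.2.mono_of_mem hJ⟩

/-- In charts a horizontal lift solves a controlled equation, the control being the coordinate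
covector of the base geodesic. -/
theorem HorLiftAt.hasDerivWithinAt {e : OpenPartialHomeomorph Q EQ}
    {ψ : OpenPartialHomeomorph B EB}
    (he : e ∈ IsManifold.maximalAtlas 𝓘(ℝ, EQ) ∞ Q)
    (hψ : ψ ∈ IsManifold.maximalAtlas 𝓘(ℝ, EB) ∞ B)
    (hπ : ContMDiff 𝓘(ℝ, EQ) 𝓘(ℝ, EB) ∞ π) {t : ℝ} (h : HorLiftAt π gQ γ β J σ t)
    (ht : σ t ∈ e.source) (ht' : γ t ∈ ψ.source) :
    HasDerivWithinAt (fun s => e (σ s))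
      (liftMap gQ π e ψ (e (σ t)) (covec ψ (γ t) (β t))) J t := by
  rw [← h.1] at ht' ⊢
  rw [liftMap_covec he hψ hπ ht ht']
  exact (hasVelocityWithinAt_iff_chart h.2.continuousWithinAt he ht).1 h.2

theorem continuousWithinAt_covec {ψ : OpenPartialHomeomorph B EB}
    (hβ : IsHamiltonianTrajectory (E := EB) (RiemannianMetric.toSub gB).hamiltonian I γ β)
    (hψ : ψ ∈ IsManifold.maximalAtlas 𝓘(ℝ, EB) ∞ B) {t : ℝ} (ht : t ∈ I) (ht' : γ t ∈ ψ.source) :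
    ContinuousWithinAt (fun s => covec ψ (γ s) (β s)) I t :=
  ((((RiemannianMetric.toSub gB).isHamiltonianTrajectory_iff.1 hβ).2 t ht ψ hψ
    ht').2).continuousWithinAt

/-- Horizontal lifts with a common point agree near it. -/
theorem IsHorLift.eventually_eq (hπ : ContMDiff 𝓘(ℝ, EQ) 𝓘(ℝ, EB) ∞ π)
    (hβ : IsHamiltonianTrajectory (E := EB) (RiemannianMetric.toSub gB).hamiltonian I γ β)
    (hJ : J.OrdConnected) (hJI : J ⊆ I) (h : IsHorLift π gQ γ β J σ)
    (h' : IsHorLift π gQ γ β J σ') {t : ℝ} (ht : t ∈ J) (heq : σ t = σ' t) :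
    ∀ᶠ s in 𝓝[J] t, σ s = σ' s := by
  have he := IsManifold.chart_mem_maximalAtlas (I := 𝓘(ℝ, EQ)) (n := ∞) (σ t)
  have hψ := IsManifold.chart_mem_maximalAtlas (I := 𝓘(ℝ, EB)) (n := ∞) (γ t)
  have hes := mem_chart_source EQ (σ t)
  have hψs := mem_chart_source EB (γ t)
  set e := chartAt EQ (σ t)
  set ψ := chartAt EB (γ t)
  have hψs' : π (σ t) ∈ ψ.source := (h t ht).1.symm ▸ hψs
  have hγ : ∀ᶠ s in 𝓝[J] t, γ s ∈ ψ.source :=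
    (hβ.1.mono hJI) t ht (ψ.open_source.mem_nhds hψs)
  have hσ : ∀ᶠ s in 𝓝[J] t, σ s ∈ e.source := h.continuousOn t ht (e.open_source.mem_nhds hes)
  have hσ' : ∀ᶠ s in 𝓝[J] t, σ' s ∈ e.source :=
    h'.continuousOn t ht (e.open_source.mem_nhds (heq ▸ hes))
  have key := eventually_eq_of_controlled_ode (A := liftMap gQ π e ψ) (I := J)
    (w := fun s => covec ψ (γ s) (β s)) (y₁ := fun s => e (σ s)) (y₂ := fun s => e (σ' s)) hJ ht
    ((continuousWithinAt_covec hβ hψ (hJI ht) hψs).mono hJI)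
    ((contDiffAt_liftMap he hψ hπ (mem_chartDomain hes hψs')).of_le (by simp)) ?_ ?_
    (congrArg e heq)
  · filter_upwards [key, hσ, hσ'] with s hs h1 h2 using e.injOn h1 h2 hs
  · filter_upwards [hγ, hσ, self_mem_nhdsWithin] with s h1 h2 h3
    exact (h s h3).hasDerivWithinAt he hψ hπ h2 h1
  · filter_upwards [hγ, hσ', self_mem_nhdsWithin] with s h1 h2 h3
    exact (h' s h3).hasDerivWithinAt he hψ hπ h2 h1

/-- Horizontal lifts with a common point agree. -/
theorem IsHorLift.eqOn [T2Space Q] (hπ : ContMDiff 𝓘(ℝ, EQ) 𝓘(ℝ, EB) ∞ π)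
    (hβ : IsHamiltonianTrajectory (E := EB) (RiemannianMetric.toSub gB).hamiltonian I γ β)
    (hJ : J.OrdConnected) (hJI : J ⊆ I) (h : IsHorLift π gQ γ β J σ)
    (h' : IsHorLift π gQ γ β J σ') {t : ℝ} (ht : t ∈ J) (heq : σ t = σ' t) : EqOn σ σ' J := by
  have : PreconnectedSpace J := Subtype.preconnectedSpace hJ.isPreconnected
  -- The coincidence set is closed because `Q` is Hausdorff and open by local uniqueness.
  have hcl : IsClopen {s : J | σ s = σ' s} := by
    refine ⟨isClosed_eq h.continuousOn.domRestrict h'.continuousOn.domRestrict, ?_⟩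
    rw [isOpen_iff_mem_nhds]
    intro s hs
    exact mem_nhds_subtype_iff_nhdsWithin.2 (by
      filter_upwards [h.eventually_eq hπ hβ hJ hJI h' s.2 hs, self_mem_nhdsWithin] with r hr hrJ
      exact ⟨⟨r, hrJ⟩, hr, rfl⟩)
  intro s hs
  have := hcl.eq_univ ⟨⟨t, ht⟩, heq⟩
  exact (this.symm ▸ mem_univ _ : (⟨s, hs⟩ : J) ∈ {s : J | σ s = σ' s})

/-- Local existence of horizontal lifts. -/
theorem exists_horLift_local (h : IsSubriemannianSubmersion π gQ gB hor)
    (hπ : ContMDiff 𝓘(ℝ, EQ) 𝓘(ℝ, EB) ∞ π) (hI : I.OrdConnected)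
    (hβ : IsHamiltonianTrajectory (E := EB) (RiemannianMetric.toSub gB).hamiltonian I γ β)
    {t : ℝ} (ht : t ∈ I) {q : Q} (hq : π q = γ t) :
    ∃ σ : ℝ → Q, ∀ᶠ s in 𝓝[I] t, HorLiftAt π gQ γ β I σ s := by
  have he := IsManifold.chart_mem_maximalAtlas (I := 𝓘(ℝ, EQ)) (n := ∞) q
  have hψ := IsManifold.chart_mem_maximalAtlas (I := 𝓘(ℝ, EB)) (n := ∞) (γ t)
  have hes := mem_chart_source EQ q
  have hψs := mem_chart_source EB (γ t)
  set e := chartAt EQ q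
  set ψ := chartAt EB (γ t)
  have hψs' : π q ∈ ψ.source := hq ▸ hψs
  have hdom := mem_chartDomain hes hψs'
  have hγ : ∀ᶠ s in 𝓝[I] t, γ s ∈ ψ.source := hβ.1 t ht (ψ.open_source.mem_nhds hψs)
  have hw : ∀ᶠ s in 𝓝[I] t, ContinuousWithinAt (fun s => covec ψ (γ s) (β s)) I s := by
    filter_upwards [hγ, self_mem_nhdsWithin] with s h1 h2
    exact continuousWithinAt_covec hβ hψ h2 h1
  obtain ⟨y, hy0, hy⟩ := exists_controlled_ode (A := liftMap gQ π e ψ) hI ht hw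
    ((contDiffAt_liftMap he hψ hπ hdom).of_le (by simp))
  have hyc := (hy.self_of_nhdsWithin ht).continuousWithinAt
  have hyd : ∀ᶠ s in 𝓝[I] t, y s ∈ chartDomain π e ψ :=
    hyc ((isOpen_chartDomain hπ.continuous).mem_nhds (hy0.symm ▸ hdom))
  have hFq : chartMap π e ψ (e q) = ψ (γ t) := by simp [chartMap, e.left_inv hes, hq]
  -- A solution of the lift equation is not known in advance to lie over `γ`. Its projection and `γ`
  -- solve the same equation `y' = T(y) w(t)` with the same value at `t`, so they agree near `t`.
  have key := eventually_eq_of_controlled_ode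
    (A := (RiemannianMetric.toSub gB).chartCometric ψ) (I := I)
    (w := fun s => covec ψ (γ s) (β s)) (y₁ := fun s => chartMap π e ψ (y s))
    (y₂ := fun s => ψ (γ s)) hI ht (hw.self_of_nhdsWithin ht) ?_ ?_ ?_ (by rw [hy0, hFq])
  · refine ⟨fun s => e.symm (y s), ?_⟩
    filter_upwards [key, hyd, hy, hγ, self_mem_nhdsWithin] with s h1 h2 h3 h4 h5
    have hπs : π (e.symm (y s)) = γ s := ψ.injOn h2.2 h4 h1
    refine ⟨hπs, ?_⟩
    have hc : ContinuousWithinAt (fun s => e.symm (y s)) I s :=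
      (e.continuousAt_symm h2.1).comp_continuousWithinAt h3.continuousWithinAt
    rw [hasVelocityWithinAt_iff_chart hc he (e.map_target h2.1),
      ← liftMap_covec he hψ hπ (e.map_target h2.1) h2.2, hπs, e.right_inv h2.1]
    refine h3.congr_of_eventuallyEq ?_ (e.right_inv h2.1)
    filter_upwards [h3.continuousWithinAt (e.open_target.mem_nhds h2.1)] with r hr
    exact e.right_inv hr
  · simp only [hy0, hFq]
    exact (((RiemannianMetric.toSub gB).contDiffOn_chartCometric hψ).contDiffAt
      (ψ.open_target.mem_nhds (ψ.map_source hψs))).of_le (by simp)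
  · filter_upwards [hyd, hy] with s h1 h2
    have h3 := (((contDiffAt_chartMap he hψ hπ h1).differentiableAt
      (by simp)).hasFDerivAt).comp_hasDerivWithinAt s h2
    rwa [fderiv_chartMap_liftMap he hψ hπ h h1] at h3
  · filter_upwards [hγ, self_mem_nhdsWithin] with s h1 h2
    exact (((RiemannianMetric.toSub gB).isHamiltonianTrajectory_iff.1 hβ).2 s h2 ψ hψ h1).1

/-- Horizontal lifts are projections of Hamiltonian trajectories. -/
theorem IsHorLift.isHamiltonianTrajectory (h : IsSubriemannianSubmersion π gQ gB hor)
    (hπ : ContMDiff 𝓘(ℝ, EQ) 𝓘(ℝ, EB) ∞ π)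
    (hβ : IsHamiltonianTrajectory (E := EB) (RiemannianMetric.toSub gB).hamiltonian I γ β)
    (hσ : IsHorLift π gQ γ β I σ) :
    IsHamiltonianTrajectory (E := EQ) gQ.hamiltonian I σ
      (fun t => (β t ∘L mdiff (E := EQ) (E' := EB) π (σ t) : EQ →L[ℝ] ℝ)) := by
  rw [isHamiltonianTrajectory_iff]
  refine ⟨hσ.continuousOn, fun t ht e he hes => ?_⟩
  have hψ := IsManifold.chart_mem_maximalAtlas (I := 𝓘(ℝ, EB)) (n := ∞) (γ t)
  have hψs := mem_chart_source EB (γ t)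
  set ψ := chartAt EB (γ t)
  have hψs' : π (σ t) ∈ ψ.source := (hσ t ht).1.symm ▸ hψs
  have hdom := mem_chartDomain hes hψs'
  have hγ : ∀ᶠ s in 𝓝[I] t, γ s ∈ ψ.source := hβ.1 t ht (ψ.open_source.mem_nhds hψs)
  have hσe : ∀ᶠ s in 𝓝[I] t, σ s ∈ e.source :=
    hσ.continuousOn t ht (e.open_source.mem_nhds hes)
  have hy := (hσ t ht).hasDerivWithinAt he hψ hπ hes hψs
  have hcov : ∀ s ∈ I, σ s ∈ e.source → γ s ∈ ψ.source →
      covec e (σ s) (β s ∘L mdiff π (σ s)) =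
        covec ψ (γ s) (β s) ∘L fderiv ℝ (chartMap π e ψ) (e (σ s)) := by
    intro s hs h1 h2
    rw [← (hσ s hs).1] at h2 ⊢
    exact covec_pullback he hψ hπ h1 h2 _
  have hw := (((RiemannianMetric.toSub gB).isHamiltonianTrajectory_iff.1 hβ).2 t ht ψ hψ hψs).2
  have hF2 := (contDiffAt_chartMap he hψ hπ hdom).of_le
    (m := 2) ENat.LEInfty.out
  have hF' : HasFDerivAt (fderiv ℝ (chartMap π e ψ))
      (fderiv ℝ (fderiv ℝ (chartMap π e ψ)) (e (σ t))) (e (σ t)) :=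
    ((hF2.fderiv_right (m := 1) (by norm_num)).differentiableAt (by simp)).hasFDerivAt
  have hFt : chartMap π e ψ (e (σ t)) = ψ (γ t) := by
    simp [chartMap, e.left_inv hes, (hσ t ht).1]
  unfold HamiltonEq
  rw [hcov t ht hes hψs]
  refine ⟨hy, ?_⟩
  have h1 : HasDerivWithinAt (fun s => fderiv ℝ (chartMap π e ψ) (e (σ s))) _ I t :=
    HasFDerivAt.comp_hasDerivWithinAt (l := fderiv ℝ (chartMap π e ψ)) t hF' hy
  have h2 := hw.clm_comp h1
  refine HasDerivWithinAt.congr_of_eventuallyEq (HasDerivWithinAt.congr_deriv h2 ?_) ?_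
    (hcov t ht hes hψs)
  · set w := covec ψ (γ t) (β t)
    -- The time derivative of `w ∘ F'` produces `F''(Sp, η)`, the relation between the cometrics
    -- produces `F''(η, Sp)`; symmetry makes them cancel.
    have hsnd : IsSymmSndFDerivAt ℝ (chartMap π e ψ) (e (σ t)) :=
      hF2.isSymmSndFDerivAt (by simp)
    ext η
    have h3 := fderiv_cometric_of_submersion (S := gQ.chartCometric e)
      (T := (RiemannianMetric.toSub gB).chartCometric ψ) hF2
      (((gQ.contDiffOn_chartCometric he).contDiffAt
        (e.open_target.mem_nhds (e.map_source hes))).differentiableAt (by simp))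
      ((((RiemannianMetric.toSub gB).contDiffOn_chartCometric hψ).contDiffAt
        (ψ.open_target.mem_nhds (hFt ▸ ψ.map_source hψs))).differentiableAt (by simp))
      (gQ.chartCometric_symm e) ?_ w η
    · have h4 := hsnd.eq η (liftMap gQ π e ψ (e (σ t)) w)
      rw [hFt] at h3
      simp [liftMap_apply] at h3 h4 ⊢
      rw [h3, h4]
      ring
    · filter_upwards [(isOpen_chartDomain hπ.continuous).mem_nhds hdom] with z hz w
      exact fderiv_chartMap_liftMap he hψ hπ h hz w
  · filter_upwards [hγ, hσe, self_mem_nhdsWithin] with s h1 h2 h3 using hcov s h3 h2 h1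

end Lift

/-! ### The structure group, global lifts and geodesic lifts -/

section Global

variable {EQ : Type*} [NormedAddCommGroup EQ] [NormedSpace ℝ EQ] [FiniteDimensional ℝ EQ]
  {Q : Type*} [TopologicalSpace Q] [ChartedSpace EQ Q] [IsManifold 𝓘(ℝ, EQ) ∞ Q]
  {EB : Type*} [NormedAddCommGroup EB] [NormedSpace ℝ EB] [FiniteDimensional ℝ EB]
  {B : Type*} [TopologicalSpace B] [ChartedSpace EB B] [IsManifold 𝓘(ℝ, EB) ∞ B]
  {EG : Type*} [NormedAddCommGroup EG] [NormedSpace ℝ EG]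
  {G : Type*} [Group G] [TopologicalSpace G] [ChartedSpace EG G] [MulAction G Q]
  {π : Q → B} {gQ : SubriemannianStructure EQ Q} {gB : RiemannianMetric EB B}
  {hor : ∀ q : Q, Submodule ℝ (TangentSpace 𝓘(ℝ, EQ) q)}
  {γ : ℝ → B} {β : ℝ → EB →L[ℝ] ℝ} {I J : Set ℝ} {σ σ' : ℝ → Q}

open SubriemannianStructure

theorem IsPrincipalBundle.contMDiff_smul
    (hP : IsPrincipalBundle (EQ := EQ) (EB := EB) (EG := EG) G π) (h : G) :
    ContMDiff 𝓘(ℝ, EQ) 𝓘(ℝ, EQ) ∞ (fun x : Q => h • x) :=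
  haveI := hP.smooth_action
  ContMDiffSMul.contMDiff_const_smul (I := 𝓘(ℝ, EG)) h

/-- The structure group is transitive on the fibres. -/
theorem IsPrincipalBundle.exists_smul_eq
    (hP : IsPrincipalBundle (EQ := EQ) (EB := EB) (EG := EG) G π) {q q' : Q} (hq : π q = π q') :
    ∃ h : G, h • q = q' := by
  obtain ⟨U, e, -, hbU, hs, -, -, -, he⟩ := hP.locally_trivial (π q)
  have hqs : q ∈ e.source := hs ▸ hbU
  have hqs' : q' ∈ e.source := by rw [hs, mem_preimage, ← hq]; exact hbU
  -- In a trivialization the action is left multiplication on the group factor, which dictates this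
  -- element.
  refine ⟨(e q').2 * (e q).2⁻¹, e.injOn ?_ hqs' ?_⟩
  · rw [hs, mem_preimage, hP.proj_smul]; exact hbU
  · rw [(he q hqs).2, inv_mul_cancel_right, hq, ← (he q' hqs').1]

theorem IsPrincipalBundle.surjective
    (hP : IsPrincipalBundle (EQ := EQ) (EB := EB) (EG := EG) G π) : Function.Surjective π := by
  intro b
  obtain ⟨U, e, -, hbU, -, ht, -, -, he⟩ := hP.locally_trivial b
  have hb : (b, (1 : G)) ∈ e.target := by rw [ht]; exact ⟨hbU, mem_univ _⟩
  exact ⟨e.symm (b, 1), by rw [← (he _ (e.map_target hb)).1, e.right_inv hb]⟩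

theorem IsPrincipalBundle.mdiff_smul_inv
    (hP : IsPrincipalBundle (EQ := EQ) (EB := EB) (EG := EG) G π) (h : G) (q : Q) (v : EQ) :
    mdiff (E := EQ) (E' := EQ) (fun x : Q => h • x) q
      (mdiff (E := EQ) (E' := EQ) (fun x : Q => h⁻¹ • x) (h • q) v) = v := by
  have hd : ∀ (k : G) (x : Q), MDifferentiableAt 𝓘(ℝ, EQ) 𝓘(ℝ, EQ) (fun x : Q => k • x) x :=
    fun k x => (hP.contMDiff_smul k).contMDiffAt.mdifferentiableAt (by simp)
  have h1 : mdiff (E := EQ) (E' := EQ) ((fun x : Q => h • x) ∘ fun x : Q => h⁻¹ • x) (h • q) =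
      mdiff (E := EQ) (E' := EQ) (fun x : Q => h • x) (h⁻¹ • h • q) ∘L
        mdiff (E := EQ) (E' := EQ) (fun x : Q => h⁻¹ • x) (h • q) :=
    mfderiv_comp (h • q) (hd h _) (hd h⁻¹ _)
  rw [inv_smul_smul] at h1
  rw [← ContinuousLinearMap.comp_apply, ← h1]
  have h2 : ((fun x : Q => h • x) ∘ fun x : Q => h⁻¹ • x) = id := funext fun x => smul_inv_smul h x
  rw [h2]
  exact congrArg (fun L : EQ →L[ℝ] EQ => L v) (mfderiv_id (I := 𝓘(ℝ, EQ)) (x := h • q))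

theorem IsPrincipalBundle.mdiff_proj_smul
    (hP : IsPrincipalBundle (EQ := EQ) (EB := EB) (EG := EG) G π) (h : G) (q : Q) :
    mdiff (E := EQ) (E' := EB) π (h • q) ∘L mdiff (E := EQ) (E' := EQ) (fun x : Q => h • x) q =
      mdiff (E := EQ) (E' := EB) π q := by
  have h1 : mdiff (E := EQ) (E' := EB) (π ∘ fun x : Q => h • x) q =
      mdiff (E := EQ) (E' := EB) π (h • q) ∘L mdiff (E := EQ) (E' := EQ) (fun x : Q => h • x) q :=
    mfderiv_comp q (hP.smooth_proj.contMDiffAt.mdifferentiableAt (by simp))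
      ((hP.contMDiff_smul h).contMDiffAt.mdifferentiableAt (by simp))
  have h2 : (π ∘ fun x : Q => h • x) = π := funext fun x => hP.proj_smul h x
  rw [← h1, h2]

/-- The duals of pulled back covectors are invariant under the structure group. -/
theorem IsInvariant.mdiff_smul_sharpMap (hinv : IsInvariant G gQ)
    (hP : IsPrincipalBundle (EQ := EQ) (EB := EB) (EG := EG) G π) (h : G) (q : Q)
    (w : EB →L[ℝ] ℝ) :
    mdiff (E := EQ) (E' := EQ) (fun x : Q => h • x) q (gQ.sharpMap q (w ∘L mdiff π q)) =
      gQ.sharpMap (h • q) (w ∘L mdiff π (h • q)) := by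
  obtain ⟨hv, hform⟩ := hinv h q (gQ.planeSharp q (w ∘L mdiff π q))
  have key : (⟨_, hv⟩ : gQ.plane (h • q)) = gQ.planeSharp (h • q) (w ∘L mdiff π (h • q)) := by
    apply gQ.eq_planeSharp
    intro u
    -- Invariance is stated for images of vectors at `q`, so the test vector `u` is first carried
    -- back by `h⁻¹`.
    obtain ⟨hu', -⟩ := hinv h⁻¹ (h • q) u
    rw [inv_smul_smul] at hu'
    set u' : gQ.plane q := ⟨_, hu'⟩ with hu'def
    have huu : mdiff (E := EQ) (E' := EQ) (fun x : Q => h • x) q u' = u :=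
      hP.mdiff_smul_inv h q u
    have hmem : mdiff (E := EQ) (E' := EQ) (fun x : Q => h • x) q u' ∈ gQ.dist (h • q) :=
      huu ▸ u.2
    have h1 := hform u' hmem
    have h2 : (⟨_, hmem⟩ : gQ.plane (h • q)) = u := Subtype.ext huu
    have h3 := gQ.form_planeSharp q (w ∘L mdiff π q) u'
    have h4 : w (mdiff (E := EQ) (E' := EB) π q u') = w (mdiff (E := EQ) (E' := EB) π (h • q) u) := by
      rw [← hP.mdiff_proj_smul h q, ContinuousLinearMap.comp_apply, huu]
    rw [← h2]
    refine (h1.trans h3).trans ?_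
    rw [h2]
    exact h4
  exact congrArg Subtype.val key

theorem IsHorLift.smul (hinv : IsInvariant G gQ)
    (hP : IsPrincipalBundle (EQ := EQ) (EB := EB) (EG := EG) G π)
    (hσ : IsHorLift π gQ γ β J σ) (h : G) : IsHorLift π gQ γ β J (fun t => h • σ t) := by
  intro t ht
  refine ⟨by rw [hP.proj_smul]; exact (hσ t ht).1, ?_⟩
  rw [← hinv.mdiff_smul_sharpMap hP]
  exact (hσ t ht).2.comp ((hP.contMDiff_smul h).contMDiffAt.mdifferentiableAt (by simp))

/-- Translation by the group moves a lift to any prescribed point of the fibre without shrinking its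
interval; this replaces any completeness assumption. -/
theorem IsHorLift.exists_through (hinv : IsInvariant G gQ)
    (hP : IsPrincipalBundle (EQ := EQ) (EB := EB) (EG := EG) G π)
    (hσ : IsHorLift π gQ γ β J σ) {t : ℝ} (ht : t ∈ J) {q : Q} (hq : π q = γ t) :
    ∃ σ', IsHorLift π gQ γ β J σ' ∧ σ' t = q :=
  let ⟨h, hh⟩ := hP.exists_smul_eq ((hσ t ht).1.trans hq.symm)
  ⟨_, hσ.smul hinv hP h, hh⟩

/-- Gluing of horizontal lifts on adjacent intervals. -/
theorem IsHorLift.glue {a b c : ℝ} (hab : a ≤ b) (hbc : b ≤ c)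
    (h : IsHorLift π gQ γ β (Icc a b) σ) (h' : IsHorLift π gQ γ β (Icc b c) σ')
    (heq : σ b = σ' b) : ∃ τ, IsHorLift π gQ γ β (Icc a c) τ := by
  set τ : ℝ → Q := fun t => if t ≤ b then σ t else σ' t with hτ
  have h1 : EqOn τ σ (Icc a b) := fun t ht => if_pos ht.2
  have h2 : EqOn τ σ' (Icc b c) := fun t ht => by
    rcases ht.1.eq_or_lt with rfl | hlt
    · simp [hτ, heq]
    · exact if_neg (not_le.2 hlt)
  have h3 : IsHorLift π gQ γ β (Icc a b) τ := fun t ht => (h t ht).congr h1 ht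
  have h4 : IsHorLift π gQ γ β (Icc b c) τ := fun t ht => (h' t ht).congr h2 ht
  refine ⟨τ, fun t ht => ?_⟩
  rcases lt_trichotomy t b with hlt | rfl | hlt
  · refine (h3 t ⟨ht.1, hlt.le⟩).mono_of_mem ?_
    filter_upwards [self_mem_nhdsWithin, mem_nhdsWithin_of_mem_nhds (Iio_mem_nhds hlt)]
      with s hs hs' using ⟨hs.1, hs'.le⟩
  · have hl := h3 t ⟨hab, le_rfl⟩
    have hr := h4 t ⟨le_rfl, hbc⟩
    rw [← Icc_union_Icc_eq_Icc hab hbc]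
    exact ⟨hl.1, hl.2.union hr.2⟩
  · refine (h4 t ⟨hlt.le, ht.2⟩).mono_of_mem ?_
    filter_upwards [self_mem_nhdsWithin, mem_nhdsWithin_of_mem_nhds (Ioi_mem_nhds hlt)]
      with s hs hs' using ⟨hs'.le, hs.2⟩

/-- Horizontal lifts exist on compact subintervals. -/
theorem exists_horLift_uIcc (h : IsSubriemannianSubmersion π gQ gB hor)
    (hinv : IsInvariant G gQ) (hP : IsPrincipalBundle (EQ := EQ) (EB := EB) (EG := EG) G π)
    (hsurj : ∀ t ∈ I, ∃ q, π q = γ t) (hI : I.OrdConnected)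
    (hβ : IsHamiltonianTrajectory (E := EB) (RiemannianMetric.toSub gB).hamiltonian I γ β)
    {s t : ℝ} (hs : s ∈ I) (ht : t ∈ I) : ∃ σ, IsHorLift π gQ γ β (uIcc s t) σ := by
  have hglue : ∀ a b c, a ∈ I → c ∈ I → a ≤ b → b ≤ c → (∃ σ, IsHorLift π gQ γ β (Icc a b) σ) →
      (∃ σ, IsHorLift π gQ γ β (Icc b c) σ) → ∃ σ, IsHorLift π gQ γ β (Icc a c) σ := by
    rintro a b c ha hc hab hbc ⟨σ, hσ⟩ ⟨σ', hσ'⟩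
    obtain ⟨τ, hτ, heq⟩ := hσ'.exists_through hinv hP ⟨le_rfl, hbc⟩ (hσ b ⟨hab, le_rfl⟩).1
    exact hσ.glue hab hbc hτ heq.symm
  -- Being joined by an interval that carries a lift is a symmetric, transitive relation that holds
  -- between nearby times, so by connectedness it holds on all of `I`.
  refine hI.isPreconnected.induction₂ (fun s t => ∃ σ, IsHorLift π gQ γ β (uIcc s t) σ)
    (fun s hs => ?_) (fun a b c ha hb hc hab hbc => ?_)
    (fun a b _ _ hab => by rwa [uIcc_comm]) hs ht
  · obtain ⟨q, hq⟩ := hsurj s hs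
    obtain ⟨σ, hσ⟩ := exists_horLift_local h hP.smooth_proj hI hβ hs hq
    obtain ⟨a, b, hsab, habI, hab, hnhd⟩ := exists_Icc_mem_nhdsWithin hI hs hσ
    filter_upwards [hnhd] with t ht
    have hsub : uIcc s t ⊆ Icc a b := ordConnected_Icc.uIcc_subset hsab ht
    exact ⟨σ, fun r hr => ⟨(hab (hsub hr)).1, (hab (hsub hr)).2.mono (hsub.trans habI)⟩⟩
  -- If `b` lies between `a` and `c` the lifts are glued; otherwise one of the two given intervals
  -- already contains the one from `a` to `c`.
  · by_cases hbm : b ∈ uIcc a c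
    · rcases le_total a c with hac | hac
      · rw [uIcc_of_le hac] at hbm ⊢
        rw [uIcc_of_le hbm.1] at hab
        rw [uIcc_of_le hbm.2] at hbc
        exact hglue a b c ha hc hbm.1 hbm.2 hab hbc
      · rw [uIcc_of_ge hac] at hbm ⊢
        rw [uIcc_of_ge hbm.2] at hab
        rw [uIcc_of_ge hbm.1] at hbc
        exact hglue c b a hc ha hbm.1 hbm.2 hbc hab
    · obtain ⟨σ, hσ⟩ := hab
      obtain ⟨σ', hσ'⟩ := hbc
      rw [mem_uIcc] at hbm
      by_cases hsub : c ∈ uIcc a b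
      · exact ⟨σ, hσ.mono (uIcc_subset_uIcc left_mem_uIcc hsub)⟩
      · refine ⟨σ', hσ'.mono (uIcc_subset_uIcc ?_ right_mem_uIcc)⟩
        rw [mem_uIcc] at hsub ⊢
        grind

/-- Horizontal lifts exist globally. -/
theorem exists_horLift [T2Space Q] (h : IsSubriemannianSubmersion π gQ gB hor)
    (hinv : IsInvariant G gQ) (hP : IsPrincipalBundle (EQ := EQ) (EB := EB) (EG := EG) G π)
    (hsurj : ∀ t ∈ I, ∃ q, π q = γ t) (hI : I.OrdConnected)
    (hβ : IsHamiltonianTrajectory (E := EB) (RiemannianMetric.toSub gB).hamiltonian I γ β)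
    {t₀ : ℝ} (ht₀ : t₀ ∈ I) {q : Q} (hq : π q = γ t₀) :
    ∃ σ, IsHorLift π gQ γ β I σ ∧ σ t₀ = q := by
  classical
  have hex : ∀ a ∈ I, ∀ b ∈ I, t₀ ∈ uIcc a b →
      ∃ σ, IsHorLift π gQ γ β (uIcc a b) σ ∧ σ t₀ = q := fun a ha b hb hab =>
    let ⟨_, hσ⟩ := exists_horLift_uIcc h hinv hP hsurj hI hβ ha hb
    hσ.exists_through hinv hP hab hq
  have : Nonempty (ℝ → Q) := ⟨fun _ => q⟩
  -- The global lift is the diagonal `t ↦ σ t t`, where `σ t` is the lift through `q` on the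
  -- interval between `t₀` and `t`; uniqueness makes the choices consistent.
  choose! σ hσ hσ0 using fun t (ht : t ∈ I) => hex t₀ ht₀ t ht left_mem_uIcc
  have heq : ∀ a ∈ I, ∀ b ∈ I, t₀ ∈ uIcc a b → ∀ τ, IsHorLift π gQ γ β (uIcc a b) τ → τ t₀ = q →
      EqOn (fun t => σ t t) τ (uIcc a b) := by
    intro a ha b hb hab τ hτ hτ0 s hs
    have hsub := hI.uIcc_subset ha hb
    have hsI := hsub hs
    exact (hσ s hsI).eqOn hP.smooth_proj hβ ordConnected_uIcc (hI.uIcc_subset ht₀ hsI)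
      (hτ.mono (uIcc_subset_uIcc hab hs)) left_mem_uIcc ((hσ0 s hsI).trans hτ0.symm) right_mem_uIcc
  refine ⟨fun t => σ t t, fun t ht => ?_, hσ0 t₀ ht₀⟩
  obtain ⟨a, b, htab, habI, -, hnhd⟩ := exists_Icc_mem_nhdsWithin hI ht Filter.univ_mem
  have hle := htab.1.trans htab.2
  -- The interval is enlarged to contain `t₀` as well as a neighbourhood of `t` in `I`; on it the
  -- diagonal agrees with a single lift and inherits its velocity.
  have ha : min t₀ a ∈ I := by
    rcases min_choice t₀ a with h | h <;> rw [h]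
    exacts [ht₀, habI (left_mem_Icc.2 hle)]
  have hb : max t₀ b ∈ I := by
    rcases max_choice t₀ b with h | h <;> rw [h]
    exacts [ht₀, habI (right_mem_Icc.2 hle)]
  have hsub : Icc a b ⊆ uIcc (min t₀ a) (max t₀ b) := fun s hs =>
    mem_uIcc.2 (Or.inl ⟨(min_le_right _ _).trans hs.1, hs.2.trans (le_max_right _ _)⟩)
  have h0 : t₀ ∈ uIcc (min t₀ a) (max t₀ b) :=
    mem_uIcc.2 (Or.inl ⟨min_le_left _ _, le_max_left _ _⟩)
  obtain ⟨τ, hτ, hτ0⟩ := hex _ ha _ hb h0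
  exact ((hτ t (hsub htab)).congr (heq _ ha _ hb h0 τ hτ hτ0) (hsub htab)).mono_of_mem
    (Filter.mem_of_superset hnhd hsub)

/-- A geodesic lift with horizontal initial velocity is a horizontal lift. -/
theorem IsHorizontalGeodesicLift.isHorLift (h : IsSubriemannianSubmersion π gQ gB hor)
    (hπ : ContMDiff 𝓘(ℝ, EQ) 𝓘(ℝ, EB) ∞ π) (hI : I.OrdConnected) (hI0 : (0 : ℝ) ∈ I)
    (hI' : I.Nontrivial)
    (hβ : IsHamiltonianTrajectory (E := EB) (RiemannianMetric.toSub gB).hamiltonian I γ β)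
    {q : Q} (hσ : IsHorizontalGeodesicLift π gQ hor I γ q σ) : IsHorLift π gQ γ β I σ := by
  -- On an interval with more than one point velocities, one-sided at the ends, are unique.
  have hu : UniqueDiffOn ℝ I := uniqueDiffOn_convex hI.convex
    (hI.convex.nontrivial_iff_nonempty_interior.1 hI')
  obtain ⟨c, hc⟩ : ∃ c : ℝ, ∀ t ∈ I, ∃ v : gQ.plane (σ t),
      HasVelocityWithinAt (E := EQ) σ I t (v : EQ) ∧ gQ.form (σ t) v v = c := by
    rcases hσ.geodesic with ⟨α, hα⟩ | ⟨⟨c, hc⟩, -⟩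
    · refine ⟨(α 0 : EQ →L[ℝ] ℝ) (gQ.sharpMap (σ 0) (α 0)), fun t ht =>
        ⟨gQ.planeSharp (σ t) (α t), gQ.hasVelocityWithinAt_of_trajectory hα ht, ?_⟩⟩
      exact (gQ.form_planeSharp (σ t) (α t) _).trans (gQ.energy_const hI hα ht hI0)
    · exact ⟨c, hc⟩
  have hproj : ∀ t ∈ I, ∀ v : EQ, HasVelocityWithinAt (E := EQ) σ I t v →
      mdiff (E := EQ) (E' := EB) π (σ t) v = (RiemannianMetric.toSub gB).sharpMap (π (σ t)) (β t) := by
    intro t ht v hv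
    rw [hσ.lift t ht]
    have h1 := (hv.comp (f := π) (hπ.contMDiffAt.mdifferentiableAt (by simp))).congr
      (γ' := γ) (fun s hs => (hσ.lift s hs).symm) ht
    exact h1.unique (hu t ht) ((RiemannianMetric.toSub gB).hasVelocityWithinAt_of_trajectory hβ ht)
  have hc0 : c = β 0 ((RiemannianMetric.toSub gB).sharpMap (γ 0) (β 0)) := by
    obtain ⟨v, hv, hvc⟩ := hc 0 hI0
    obtain ⟨w, hw, hw'⟩ := hσ.velocity
    have hvw : (v : EQ) = w := hv.unique (hu 0 hI0) hw'
    rw [← hvc, ← hσ.lift 0 hI0]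
    exact h.form_self_eq_of_mem_hor (hvw ▸ hw) (hproj 0 hI0 v hv)
  intro t ht
  refine ⟨hσ.lift t ht, ?_⟩
  obtain ⟨v, hv, hvc⟩ := hc t ht
  rw [← h.eq_sharpMap_of_form_eq (hproj t ht v hv) ?_]
  · exact hv
  · rw [hvc, hc0, hσ.lift t ht]
    exact (RiemannianMetric.toSub gB).energy_const hI hβ hI0 ht

end Global

end SubRiem

end

/-! ### The theorem -/

theorem mainTheorem8
    {EQ : Type*} [NormedAddCommGroup EQ] [NormedSpace ℝ EQ] [FiniteDimensional ℝ EQ]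
    {Q : Type*} [TopologicalSpace Q] [ChartedSpace EQ Q] [IsManifold 𝓘(ℝ, EQ) ∞ Q] [T2Space Q]
    {EB : Type*} [NormedAddCommGroup EB] [NormedSpace ℝ EB] [FiniteDimensional ℝ EB]
    {B : Type*} [TopologicalSpace B] [ChartedSpace EB B] [IsManifold 𝓘(ℝ, EB) ∞ B] [T2Space B]
    {EG : Type*} [NormedAddCommGroup EG] [NormedSpace ℝ EG] [FiniteDimensional ℝ EG]
    {G : Type*} [Group G] [TopologicalSpace G] [ChartedSpace EG G] [LieGroup 𝓘(ℝ, EG) ∞ G]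
    [MulAction G Q]
    (π : Q → B) (hπ : SubRiem.IsPrincipalBundle (EQ := EQ) (EB := EB) (EG := EG) G π)
    (gB : SubRiem.RiemannianMetric EB B) (gQ : SubRiem.SubriemannianStructure EQ Q)
    (hor : ∀ q : Q, Submodule ℝ (TangentSpace 𝓘(ℝ, EQ) q))
    (hsub : SubRiem.IsSubriemannianSubmersion π gQ gB hor)
    (hinv : SubRiem.IsInvariant G gQ)
    (b : B) (q : Q) (hq : π q = b)
    (I : Set ℝ) (hI : I.OrdConnected) (hI0 : (0 : ℝ) ∈ I) (hI' : I.Nontrivial)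
    (γ : ℝ → B) (hγ : SubRiem.IsRiemannianGeodesic gB I γ) (hγ0 : γ 0 = b) :
    (∃ γ' : ℝ → Q, SubRiem.IsHorizontalGeodesicLift π gQ hor I γ q γ') ∧
    (∀ γ₁ γ₂ : ℝ → Q, SubRiem.IsHorizontalGeodesicLift π gQ hor I γ q γ₁ →
      SubRiem.IsHorizontalGeodesicLift π gQ hor I γ q γ₂ → EqOn γ₁ γ₂ I) ∧
    (∀ γ' : ℝ → Q, SubRiem.IsHorizontalGeodesicLift π gQ hor I γ q γ' →
      gQ.IsNormalGeodesic I γ') := by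

  obtain ⟨β, hβ⟩ := hγ
  -- Viewed as a subriemannian structure, the base metric has a cometric to which the same lemmas
  -- apply as on `Q`.
  rw [← SubRiem.RiemannianMetric.hamiltonian_toSub] at hβ
  have hnormal : ∀ σ, SubRiem.IsHorLift (EQ := EQ) (EB := EB) π gQ γ β I σ →
      gQ.IsNormalGeodesic I σ :=
    fun σ hσ => ⟨_, hσ.isHamiltonianTrajectory hsub hπ.smooth_proj hβ⟩
  have hlift : ∀ σ, SubRiem.IsHorizontalGeodesicLift π gQ hor I γ q σ →
      SubRiem.IsHorLift (EQ := EQ) (EB := EB) π gQ γ β I σ :=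
    fun σ hσ => hσ.isHorLift hsub hπ.smooth_proj hI hI0 hI' hβ
  refine ⟨?_, fun γ₁ γ₂ h₁ h₂ => ?_, fun σ hσ => hnormal σ (hlift σ hσ)⟩
  · have hsurj : ∀ t ∈ I, ∃ x, π x = γ t := fun t _ => hπ.surjective (γ t)
    obtain ⟨σ, hσ, hσ0⟩ := SubRiem.exists_horLift hsub hinv hπ hsurj hI hβ hI0 (hq.trans hγ0.symm)
    exact ⟨σ, fun t ht => (hσ t ht).1, hσ0, Or.inl (hnormal σ hσ), _,
      (hsub.sharpMap_pullback _ _).1, (hσ 0 hI0).2⟩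
  · exact (hlift γ₁ h₁).eqOn hπ.smooth_proj hβ hI subset_rfl (hlift γ₂ h₂) hI0
      (h₁.start.trans h₂.start.symm)
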